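/- Call $\mathsf M=(M,d,\mu)$ a metric probability space if $(M,d)$ is a metric space and $\mu$ is a Borel probability measure on it. For a finite $K\ge 0$ and $0<\rho\le 1$, say that $\mathsf M$ has $(K,\rho)$-expansion if there is a finitely supported probability measure $\mathsf P$ on the set of measure-preserving bijections $\phi:M\to M$ such that (E1) $\operatorname{Lip}(\phi)\le K$ and $\operatorname{Lip}(\phi^{-1})\le K$ for every $\phi\in\operatorname{supp}\mathsf P$; and (E2) for every $n\ge 1$ and every complex-valued $f\in L^2(M^n,\mu^n)$ with $\int f\,d\mu^n=0$, the averaging operator $T_{\mathsf P}f(x_1,\dots,x_n)=\mathbb E_{\phi\sim\mathsf P}\bigl[f(\phi(x_1),\dots,\phi(x_n))\bigr]$ satisfies $\|T_{\mathsf P}f\|_2\le(1-\rho)\|f\|_2$. Say that $\mathsf M$ expands uniformly if it has $(K,\rho)$-expansion for some finite $K$ and some $0<\rho\le1$ (neither depending on $n$). Let $S^d\subset\mathbb R^{d+1}$ denote the round unit sphere with its geodesic metric $d(x,y)=\arccos\langle x,y\rangle$ and its normalised surface area measure. Proposition. Let $m\ge 3$. If $S^{m-1}$ expands uniformly, then so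 does $S^m$. -/

import Mathlib

open MeasureTheory
open scoped NNReal ENNReal

noncomputable section

/-! ### Uniform expansion of a metric probability space -/

/-- The measure-preserving bijections `φ : M → M` of a measure space `(M, μ)`. -/
abbrev MeasurePreservingBijection {M : Type*} [MeasurableSpace M] (μ : Measure M) : Type _ :=
  {φ : M ≃ M // MeasurePreserving φ μ μ}

/-- A finitely supported probability measure `P` on measure-preserving bijections, given by its
point masses. -/
def IsProbabilityWeight {α : Type*} (P : α →₀ ℝ) : Prop :=
  (∀ φ, 0 ≤ P φ) ∧ P.sum (fun _ w => w) = 1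

/-- The averaging operator
`T_P f (x₁, …, xₙ) = 𝔼_{φ ∼ P} [f (φ x₁, …, φ xₙ)]` (the same `φ` in every coordinate). -/
def averagingOperator {M : Type*} [MeasurableSpace M] {μ : Measure M}
    (P : MeasurePreservingBijection μ →₀ ℝ) {n : ℕ} (f : (Fin n → M) → ℂ) :
    (Fin n → M) → ℂ :=
  fun x => P.sum fun φ w => (w : ℂ) * f (fun i => φ.1 (x i))

/-- `(K, ρ)`-expansion of the metric probability space `(M, dist, μ)`.  An element of `L²₀(Mⁿ)` is
given by a complex-valued square-integrable function on `Mⁿ` with integral zero. -/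
def HasExpansion (M : Type*) [MetricSpace M] [MeasurableSpace M] [BorelSpace M]
    (μ : Measure M) [IsProbabilityMeasure μ] (K : ℝ≥0) (ρ : ℝ) : Prop :=
  ∃ P : MeasurePreservingBijection μ →₀ ℝ,
    IsProbabilityWeight P ∧
    (∀ φ ∈ P.support, LipschitzWith K φ.1 ∧ LipschitzWith K φ.1.symm) ∧
    ∀ n : ℕ, 1 ≤ n → ∀ f : (Fin n → M) → ℂ,
      MemLp f 2 (Measure.pi fun _ => μ) →
      ∫ x, f x ∂(Measure.pi fun _ => μ) = 0 →
      eLpNorm (averagingOperator P f) 2 (Measure.pi fun _ => μ) ≤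
        ENNReal.ofReal (1 - ρ) * eLpNorm f 2 (Measure.pi fun _ => μ)

/-- `(M, dist, μ)` expands uniformly: it has `(K, ρ)`-expansion for some finite `K` and some
`0 < ρ ≤ 1`; neither depends on the number `n` of points. -/
def ExpandsUniformly (M : Type*) [MetricSpace M] [MeasurableSpace M] [BorelSpace M]
    (μ : Measure M) [IsProbabilityMeasure μ] : Prop :=
  ∃ (K : ℝ≥0) (ρ : ℝ), 0 < ρ ∧ ρ ≤ 1 ∧ HasExpansion M μ K ρ

/-! ### The round sphere -/

/-- The unit sphere `S^d` in `ℝ^(d+1)`.  This is a type synonym because it carries the geodesic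
metric, whereas `Metric.sphere 0 1` carries the chordal one. -/
def RoundSphere (d : ℕ) : Type :=
  Metric.sphere (0 : EuclideanSpace ℝ (Fin (d + 1))) 1

namespace RoundSphere

/-- The inclusion `S^d ⊆ ℝ^(d+1)`. -/
def coords {d : ℕ} (x : RoundSphere d) : EuclideanSpace ℝ (Fin (d + 1)) :=
  Subtype.val (p := (· ∈ Metric.sphere (0 : EuclideanSpace ℝ (Fin (d + 1))) 1)) x

theorem norm_coords {d : ℕ} (x : RoundSphere d) : ‖x.coords‖ = 1 :=
  mem_sphere_zero_iff_norm.1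
    (Subtype.property (p := (· ∈ Metric.sphere (0 : EuclideanSpace ℝ (Fin (d + 1))) 1)) x)

theorem coords_ne_zero {d : ℕ} (x : RoundSphere d) : x.coords ≠ 0 := by
  intro h
  have := norm_coords x
  simp [h] at this

theorem coords_injective {d : ℕ} : Function.Injective (coords (d := d)) :=
  Subtype.val_injective

/-- The geodesic metric: the distance of two points is the angle between them, that is
`dist x y = arccos ⟪x, y⟫`. -/
instance instMetricSpace (d : ℕ) : MetricSpace (RoundSphere d) where
  dist x y := InnerProductGeometry.angle x.coords y.coords
  dist_self x := InnerProductGeometry.angle_self (coords_ne_zero x)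
  dist_comm x y := InnerProductGeometry.angle_comm _ _
  dist_triangle x y z := InnerProductGeometry.angle_le_angle_add_angle _ _ _
  eq_of_dist_eq_zero {x y} h := by
    apply coords_injective
    have h1 := InnerProductGeometry.norm_sub_eq_abs_sub_norm_of_angle_eq_zero h
    rw [norm_coords, norm_coords, sub_self, abs_zero, norm_eq_zero, sub_eq_zero] at h1
    exact h1

instance instMeasurableSpace (d : ℕ) : MeasurableSpace (RoundSphere d) :=
  inferInstanceAs
    (MeasurableSpace (Metric.sphere (0 : EuclideanSpace ℝ (Fin (d + 1))) 1))

theorem dist_eq_arccos {d : ℕ} (x y : RoundSphere d) :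
    dist x y = Real.arccos (inner ℝ x.coords y.coords) := by
  change InnerProductGeometry.angle _ _ = _
  simp [InnerProductGeometry.angle, norm_coords]

theorem norm_coords_sub_sq {d : ℕ} (x y : RoundSphere d) :
    ‖x.coords - y.coords‖ ^ 2 = 2 - 2 * Real.cos (dist x y) := by
  change _ = 2 - 2 * Real.cos (InnerProductGeometry.angle _ _)
  rw [@norm_sub_sq_real, InnerProductGeometry.cos_angle, norm_coords, norm_coords]
  ring

/-- The Borel sets of the geodesic metric are those induced from `ℝ^(d+1)`. -/
instance instBorelSpace (d : ℕ) : BorelSpace (RoundSphere d) := by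
  let ι : RoundSphere d → Metric.sphere (0 : EuclideanSpace ℝ (Fin (d + 1))) 1 := fun x => x
  have hι : ∀ x y, dist (ι x) (ι y) = ‖x.coords - y.coords‖ := fun x y =>
    (Subtype.dist_eq (ι x) (ι y)).trans (dist_eq_norm _ _)
  have hlip : LipschitzWith 1 ι := LipschitzWith.of_dist_le_mul fun x y => by
    rw [hι, NNReal.coe_one, one_mul]
    refine le_of_sq_le_sq ?_ dist_nonneg
    have := Real.one_sub_sq_div_two_le_cos (x := dist x y)
    rw [norm_coords_sub_sq]
    linarith
  have hanti : AntilipschitzWith (Real.toNNReal (Real.pi / 2)) ι :=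
    AntilipschitzWith.of_le_mul_dist fun x y => by
      rw [hι, Real.coe_toNNReal _ (by positivity)]
      have h0 : (0 : ℝ) ≤ dist x y := dist_nonneg
      have h1 : |dist x y| ≤ Real.pi := by
        rw [abs_of_nonneg h0]
        exact InnerProductGeometry.angle_le_pi _ _
      have h2 := Real.cos_le_one_sub_mul_cos_sq h1
      refine le_of_sq_le_sq ?_ (by positivity)
      rw [mul_pow, norm_coords_sub_sq]
      have hpi : (0 : ℝ) < Real.pi ^ 2 := by positivity
      have h3 : (Real.pi / 2) ^ 2 * (2 - 2 * (1 - 2 / Real.pi ^ 2 * dist x y ^ 2))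
          = dist x y ^ 2 := by
        field_simp
        ring
      rw [← h3]
      gcongr
  have hind : Topology.IsInducing ι :=
    (hanti.isUniformInducing hlip.uniformContinuous).isInducing
  constructor
  have h1 : borel (RoundSphere d) = MeasurableSpace.comap ι (borel _) :=
    (congrArg (fun t => @borel (RoundSphere d) t) hind.eq_induced).trans
      (borel_comap (f := ι))
  rw [h1, ← BorelSpace.measurable_eq]
  exact MeasurableSpace.comap_id.symm

/-- The surface area measure of the unit sphere `S^d`. -/
def areaMeasure (d : ℕ) : Measure (RoundSphere d) :=
  (volume : Measure (EuclideanSpace ℝ (Fin (d + 1)))).toSphere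

/-- The uniform probability measure on `S^d`: normalised surface area. -/
def uniformMeasure (d : ℕ) : Measure (RoundSphere d) :=
  (areaMeasure d Set.univ)⁻¹ • areaMeasure d

instance instIsProbabilityMeasure (d : ℕ) : IsProbabilityMeasure (uniformMeasure d) := by
  constructor
  have h0 : areaMeasure d Set.univ ≠ 0 := by
    rw [Ne, Measure.measure_univ_eq_zero]
    exact Measure.toSphere_ne_zero _
  have h1 : areaMeasure d Set.univ ≠ ∞ := by
    have : IsFiniteMeasure
      ((volume : Measure (EuclideanSpace ℝ (Fin (d + 1)))).toSphere) := inferInstance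
    exact this.measure_univ_lt_top.ne
  rw [uniformMeasure, Measure.smul_apply, smul_eq_mul, ENNReal.inv_mul_cancel h0 h1]

end RoundSphere

end

/-! A map of `S^{m-1}` suspends to `S^m`: keep the height `x₀` and move the equatorial direction.
Let `P₁` be the suspension of an expanding `P`, let `P₂` be its conjugate by the interchange of `x₀`
and `x₁`, and let `Q` be their equal mixture.

Over fixed heights of all `n` points the fibre is `(S^{m-1})ⁿ`, with the uniform product measure,
and `P₁` acts there as `P`. With `c = 1 - ρ`, this gives `‖T_{P₁} f‖² ≤ c²‖f‖² + (1 - c²)‖E₀ f‖²`,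
where `E₀` is conditional expectation on the `n` heights; likewise for `P₂`, with `E₁` conditional
expectation on the `n` values of `x₁`. Only functions of the heights escape contraction by `P₁`, so
it remains to see that a mean-zero `f` cannot be close to both kinds of function: `‖E₀ f‖² + ‖E₁ f‖²
≤ (3/2)‖f‖²` (`integral_latitudeAverage_sq_add_le`).

This holds once the maximal correlation of the two `n`-tuples of coordinates is at most `1/2`.
Maximal correlation does not grow under independent products (`MaxCorrLE.prod`, `MaxCorrLE.pi`), so
the bound is uniform in `n` and only `n = 1` matters. There `E[x₁^k | x₀ = t] = M_k (1 - t²)^{k/2}`,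
where `M_k` is the `k`-th moment of a coordinate on `S^{m-1}`. This vanishes for odd `k` and is a
polynomial with leading term `±M_k t^k` for even `k`. The correlation form is thus symmetric and
triangular on monomials, hence diagonal on orthogonal polynomials with entries `±M_k`, and `|M_k| ≤
1/2` for `k ≥ 1` (`maxCorrLE_coord`). -/

/-! ### Symmetric triangular forms on a Hilbert space -/

section Triangular

variable {H H' : Type*} [NormedAddCommGroup H] [InnerProductSpace ℝ H]
  [NormedAddCommGroup H'] [InnerProductSpace ℝ H']

/-- A pair of isometric embeddings whose cross Gram form is symmetric and triangular with respect
to a sequence with dense span satisfies the correlation bound given by the diagonal. -/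
theorem abs_inner_le_of_triangular (A A' : H →ₗᵢ[ℝ] H') (v : ℕ → H)
    (hv : Dense (Submodule.span ℝ (Set.range v) : Set H)) (hv0 : ‖v 0‖ = 1)
    (hsymm : ∀ f g, inner ℝ (A f) (A' g) = inner ℝ (A g) (A' f))
    {c : ℝ} (l : ℕ → ℝ) (hl : ∀ k, k ≠ 0 → |l k| ≤ c)
    (htri : ∀ k, ∃ q ∈ Submodule.span ℝ (v '' Set.Iio k),
      ∀ i, inner ℝ (A (v i)) (A' (v k)) = inner ℝ (v i) (l k • v k + q))
    {f g : H} (hf : inner ℝ (v 0) f = 0) (hg : inner ℝ (v 0) g = 0) :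
    |inner ℝ (A f) (A' g)| ≤ c * ‖f‖ * ‖g‖ := by
  have hc : 0 ≤ c := (abs_nonneg _).trans (hl 1 one_ne_zero)
  set e : ℕ → H := InnerProductSpace.gramSchmidt ℝ v with he
  have horth : ∀ i j, i ≠ j → inner ℝ (e i) (e j) = 0 := fun i j h =>
    InnerProductSpace.gramSchmidt_orthogonal ℝ v h
  have he0 : e 0 = v 0 := by
    rw [he, InnerProductSpace.gramSchmidt_def]; simp
  -- the form is represented on the span
  have hext : ∀ w q : H, (∀ i, inner ℝ (A (v i)) (A' w) = inner ℝ (v i) q) →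
      ∀ x ∈ Submodule.span ℝ (Set.range v), inner ℝ (A x) (A' w) = inner ℝ x q := by
    intro w q h x hx
    induction hx using Submodule.span_induction with
    | mem x hx => obtain ⟨i, rfl⟩ := hx; exact h i
    | zero => simp
    | add x y _ _ hx hy => simp [inner_add_left, hx, hy]
    | smul a x _ hx => simp [inner_smul_left, hx]
  have hrep : ∀ k, ∀ w ∈ Submodule.span ℝ (v '' Set.Iio k),
      ∃ q ∈ Submodule.span ℝ (v '' Set.Iio k),
        ∀ x ∈ Submodule.span ℝ (Set.range v), inner ℝ (A x) (A' w) = inner ℝ x q := by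
    intro k w hw
    induction hw using Submodule.span_induction with
    | mem w hw =>
      obtain ⟨j, hj, rfl⟩ := hw
      obtain ⟨q, hq, h⟩ := htri j
      refine ⟨_, ?_, hext _ _ h⟩
      refine Submodule.add_mem _ (Submodule.smul_mem _ _ (Submodule.subset_span ⟨j, hj, rfl⟩)) ?_
      refine Submodule.span_mono (Set.image_mono ?_) hq
      exact Set.Iio_subset_Iio (le_of_lt hj)
    | zero => exact ⟨0, Submodule.zero_mem _, by simp⟩
    | add x y _ _ hx hy =>
      obtain ⟨p, hp, h1⟩ := hx
      obtain ⟨q, hq, h2⟩ := hy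
      exact ⟨p + q, Submodule.add_mem _ hp hq, fun x hx => by
        simp [inner_add_right, h1 x hx, h2 x hx]⟩
    | smul a x _ hx =>
      obtain ⟨p, hp, h1⟩ := hx
      exact ⟨a • p, Submodule.smul_mem _ _ hp, fun x hx => by
        simp [inner_smul_right, h1 x hx]⟩
  have hperp : ∀ k, ∀ q ∈ Submodule.span ℝ (v '' Set.Iio k), inner ℝ (e k) q = 0 := by
    intro k q hq
    rw [← InnerProductSpace.span_gramSchmidt_Iio] at hq
    induction hq using Submodule.span_induction with
    | mem w hw => obtain ⟨j, hj, rfl⟩ := hw; exact horth _ _ (ne_of_gt hj)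
    | zero => simp
    | add x y _ _ hx hy => simp [inner_add_right, hx, hy]
    | smul a x _ hx => simp [inner_smul_right, hx]
  have hemem : ∀ k, e k ∈ Submodule.span ℝ (Set.range v) := fun k => by
    rw [← InnerProductSpace.span_gramSchmidt]; exact Submodule.subset_span ⟨k, rfl⟩
  -- Triangularity represents the form against `e j` by a vector of the span below `k`, orthogonal
  -- to `e k`. Symmetry then disposes of the other triangle.
  have hlt : ∀ j k, j < k → inner ℝ (A (e k)) (A' (e j)) = 0 := by
    intro j k hjk
    obtain ⟨q, hq, h⟩ := hrep k (e j) (by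
      rw [← InnerProductSpace.span_gramSchmidt_Iio]; exact Submodule.subset_span ⟨j, hjk, rfl⟩)
    rw [h _ (hemem k), hperp k q hq]
  have hoff : ∀ j k, j ≠ k → inner ℝ (A (e j)) (A' (e k)) = 0 := by
    intro j k hjk
    rcases lt_or_gt_of_ne hjk with h | h
    · rw [hsymm, hlt _ _ h]
    · exact hlt _ _ h
  -- Lower-order terms are invisible to `e k`. The `e k` are not normalised and may vanish, so `v`
  -- need not be linearly independent.
  have hdiag : ∀ k, inner ℝ (A (e k)) (A' (e k)) = l k * ‖e k‖ ^ 2 := by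
    intro k
    obtain ⟨r, hr, hvk⟩ : ∃ r ∈ Submodule.span ℝ (v '' Set.Iio k), v k = e k + r := by
      refine ⟨_, ?_, InnerProductSpace.gramSchmidt_def' ℝ v k⟩
      rw [← InnerProductSpace.span_gramSchmidt_Iio]
      refine Submodule.sum_mem _ fun i hi => ?_
      refine Submodule.span_mono ?_ (Submodule.coe_mem _)
      rintro _ rfl
      exact ⟨i, Finset.mem_Iio.1 hi, rfl⟩
    obtain ⟨q, hq, h⟩ := htri k
    obtain ⟨q', hq', h'⟩ := hrep k r hr
    have h1 := hext _ _ h _ (hemem k)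
    have h2 := h' _ (hemem k)
    rw [hperp k q' hq'] at h2
    rw [hvk, map_add, inner_add_right, h2, add_zero, smul_add, inner_add_right, inner_add_right,
      inner_smul_right, inner_smul_right, hperp k q hq, hperp k r hr,
      real_inner_self_eq_norm_sq] at h1
    simpa using h1
  have hnorm : ∀ (s : Finset ℕ) (a : ℕ → ℝ),
      ‖∑ k ∈ s, a k • e k‖ = √(∑ k ∈ s, (|a k| * ‖e k‖) ^ 2) := by
    intro s a
    rw [eq_comm, Real.sqrt_eq_iff_mul_self_eq (by positivity) (norm_nonneg _),
      ← real_inner_self_eq_norm_mul_norm, sum_inner]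
    refine Finset.sum_congr rfl fun i hi => ?_
    rw [inner_sum, Finset.sum_eq_single i]
    · rw [inner_smul_left, inner_smul_right, real_inner_self_eq_norm_sq, mul_pow, sq_abs]
      simp; ring
    · intro j _ hj
      rw [inner_smul_left, inner_smul_right, horth i j hj.symm]; simp
    · exact fun h => absurd hi h
  have hsum : ∀ (s : Finset ℕ) (a b : ℕ → ℝ), a 0 = 0 →
      |inner ℝ (A (∑ k ∈ s, a k • e k)) (A' (∑ k ∈ s, b k • e k))| ≤
        c * ‖∑ k ∈ s, a k • e k‖ * ‖∑ k ∈ s, b k • e k‖ := by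
    intro s a b ha
    have h1 : inner ℝ (A (∑ k ∈ s, a k • e k)) (A' (∑ k ∈ s, b k • e k)) =
        ∑ k ∈ s, a k * b k * (l k * ‖e k‖ ^ 2) := by
      rw [map_sum, map_sum, sum_inner]
      refine Finset.sum_congr rfl fun i hi => ?_
      rw [inner_sum, Finset.sum_eq_single i]
      · rw [map_smul, map_smul, inner_smul_left, inner_smul_right, hdiag]
        simp; ring
      · intro j _ hj
        rw [map_smul, map_smul, inner_smul_left, inner_smul_right, hoff i j hj.symm]; simp
      · exact fun h => absurd hi h
    rw [h1, hnorm, hnorm, mul_assoc]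
    calc |∑ k ∈ s, a k * b k * (l k * ‖e k‖ ^ 2)|
        ≤ ∑ k ∈ s, |a k * b k * (l k * ‖e k‖ ^ 2)| := Finset.abs_sum_le_sum_abs _ _
      _ ≤ ∑ k ∈ s, c * ((|a k| * ‖e k‖) * (|b k| * ‖e k‖)) := by
          refine Finset.sum_le_sum fun k _ => ?_
          by_cases hk : k = 0
          · simp [hk, ha]
          · rw [abs_mul, abs_mul, abs_mul, abs_of_nonneg (by positivity : 0 ≤ ‖e k‖ ^ 2)]
            have := mul_le_mul_of_nonneg_right (hl k hk)
              (by positivity : 0 ≤ (|a k| * ‖e k‖) * (|b k| * ‖e k‖))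
            calc _ = |l k| * ((|a k| * ‖e k‖) * (|b k| * ‖e k‖)) := by ring
              _ ≤ _ := this
      _ = c * ∑ k ∈ s, (|a k| * ‖e k‖) * (|b k| * ‖e k‖) := by rw [Finset.mul_sum]
      _ ≤ _ := mul_le_mul_of_nonneg_left (Real.sum_mul_le_sqrt_mul_sqrt _ _ _) hc
  -- Vectors of the span approximating `f` need not be orthogonal to `v 0`. Composing with this
  -- continuous projection makes the inequality a closed condition on all of `H × H`.
  let Q : H → H := fun x => x - (inner ℝ (v 0) x : ℝ) • v 0
  have hQc : Continuous Q := by fun_prop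
  have hQ : ∀ x ∈ (Submodule.span ℝ (Set.range v) : Set H),
      ∃ a : ℕ →₀ ℝ, a 0 = 0 ∧ ∀ s, a.support ⊆ s → Q x = ∑ k ∈ s, a k • e k := by
    intro x hx
    rw [SetLike.mem_coe, ← InnerProductSpace.span_gramSchmidt,
      Finsupp.mem_span_range_iff_exists_finsupp] at hx
    obtain ⟨a, rfl⟩ := hx
    refine ⟨a.erase 0, by simp, fun s hs => ?_⟩
    have h1 : a.sum (fun i r => r • e i) = ∑ k ∈ insert 0 s, a k • e k := by
      refine Finsupp.sum_of_support_subset _ (fun k hk => ?_) _ (by simp)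
      by_cases h0 : k = 0
      · simp [h0]
      · exact Finset.mem_insert_of_mem (hs (by simp [h0] at hk ⊢; exact hk))
    have h2 : ∑ k ∈ s, (a.erase 0) k • e k = ∑ k ∈ insert 0 s, (a.erase 0) k • e k := by
      refine Finset.sum_subset (Finset.subset_insert _ _) fun k hk hk' => ?_
      have : k = 0 := by simpa [hk'] using hk
      simp [this]
    have h3 : ∑ k ∈ insert 0 s, a k • e k
        = a 0 • e 0 + ∑ k ∈ insert 0 s, (a.erase 0) k • e k := by
      rw [← Finset.add_sum_erase (insert 0 s) (fun k => a k • e k) (Finset.mem_insert_self 0 s),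
        ← Finset.add_sum_erase (insert 0 s) (fun k => (a.erase 0) k • e k)
          (Finset.mem_insert_self 0 s)]
      simp only [Finsupp.erase_same, zero_smul, zero_add]
      congr 1
      refine Finset.sum_congr rfl fun k hk => ?_
      rw [Finsupp.erase_ne (Finset.ne_of_mem_erase hk)]
    have h4 : inner ℝ (v 0) (a.sum fun i r => r • e i) = a 0 := by
      rw [h1, h3, inner_add_right, ← he0, inner_smul_right, he0, real_inner_self_eq_norm_sq, hv0,
        inner_sum, Finset.sum_eq_zero]
      · simp
      · intro k _
        by_cases hk : k = 0
        · simp [hk]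
        · rw [inner_smul_right, ← he0, horth 0 k (Ne.symm hk), mul_zero]
    change _ - _ • v 0 = _
    rw [h4, h1, h3, h2, ← he0]
    abel
  have key : ∀ x y, |inner ℝ (A (Q x)) (A' (Q y))| ≤ c * ‖Q x‖ * ‖Q y‖ := by
    intro x y
    have hcl : IsClosed {p : H × H | |inner ℝ (A (Q p.1)) (A' (Q p.2))| ≤
        c * ‖Q p.1‖ * ‖Q p.2‖} := by
      have hA := A.continuous
      have hA' := A'.continuous
      exact isClosed_le (by fun_prop) (by fun_prop)
    have hd := hv.prod hv
    have : (x, y) ∈ closure ((Submodule.span ℝ (Set.range v) : Set H) ×ˢ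
      (Submodule.span ℝ (Set.range v) : Set H)) := hd _
    refine hcl.closure_subset_iff.2 ?_ this
    rintro ⟨x, y⟩ ⟨hx, hy⟩
    obtain ⟨a, ha, hxa⟩ := hQ x hx
    obtain ⟨b, -, hyb⟩ := hQ y hy
    change |inner ℝ (A (Q x)) (A' (Q y))| ≤ c * ‖Q x‖ * ‖Q y‖
    rw [hxa _ (Finset.subset_union_left (s₂ := b.support)),
      hyb _ (Finset.subset_union_right (s₁ := a.support))]
    exact hsum _ _ _ ha
  have := key f g
  simpa [Q, hf, hg] using this

end Triangular

/-! ### Square-integrable functions on a product and their fibre means -/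

section Fibre

variable {A B : Type*} [MeasurableSpace A] [MeasurableSpace B] {α : Measure A} {β : Measure B}

theorem integral_sub_integral_sq [IsProbabilityMeasure α] {F : A → ℝ} (hF : MemLp F 2 α) :
    ∫ x, (F x - ∫ z, F z ∂α) ^ 2 ∂α = ∫ x, F x ^ 2 ∂α - (∫ x, F x ∂α) ^ 2 := by
  set m := ∫ z, F z ∂α with hm
  have h1 : Integrable F α := hF.integrable (by norm_num)
  have h2 : Integrable (fun x => F x ^ 2) α := hF.integrable_sq
  have : ∀ x, (F x - m) ^ 2 = F x ^ 2 - (2 * m) * F x + m ^ 2 := fun x => by ring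
  simp_rw [this]
  have h3 : Integrable (fun x => F x ^ 2 - 2 * m * F x) α := h2.sub (h1.const_mul _)
  rw [integral_add h3 (integrable_const _), integral_sub h2 (h1.const_mul _), integral_const_mul, ← hm, integral_const]
  simp; ring

theorem sq_integral_le_integral_sq [IsProbabilityMeasure α] {F : A → ℝ} (hF : MemLp F 2 α) :
    (∫ x, F x ∂α) ^ 2 ≤ ∫ x, F x ^ 2 ∂α := by
  have := integral_nonneg (μ := α) (f := fun x => (F x - ∫ z, F z ∂α) ^ 2)
    fun x => sq_nonneg _
  rw [integral_sub_integral_sq hF] at this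
  linarith

theorem MeasureTheory.MemLp.ae_fibre [SFinite α] [SFinite β] {F : A × B → ℝ} (hF : MemLp F 2 (α.prod β)) :
    ∀ᵐ x ∂α, MemLp (fun y => F (x, y)) 2 β := by
  filter_upwards [hF.1.prodMk_left, hF.integrable_sq.prod_right_ae] with x h1 h2
  exact (memLp_two_iff_integrable_sq h1).2 h2

theorem MeasureTheory.MemLp.integral_fibre [SFinite α] [IsProbabilityMeasure β] {F : A × B → ℝ}
    (hF : MemLp F 2 (α.prod β)) : MemLp (fun x => ∫ y, F (x, y) ∂β) 2 α := by
  have hm : AEStronglyMeasurable (fun x => ∫ y, F (x, y) ∂β) α := hF.1.integral_prod_right'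
  rw [memLp_two_iff_integrable_sq hm]
  refine hF.integrable_sq.integral_prod_left.mono' (hm.pow 2) ?_
  filter_upwards [hF.ae_fibre] with x hx
  rw [Real.norm_of_nonneg (sq_nonneg _)]
  exact sq_integral_le_integral_sq hx

theorem MeasureTheory.MemLp.norm_toLp_eq_sqrt {F : A → ℝ} (hF : MemLp F 2 α) :
    ‖hF.toLp‖ = √(∫ x, F x ^ 2 ∂α) := by
  rw [eq_comm, Real.sqrt_eq_iff_mul_self_eq (integral_nonneg fun _ => sq_nonneg _)
    (norm_nonneg _), ← real_inner_self_eq_norm_mul_norm, L2.inner_def]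
  refine integral_congr_ae ?_
  filter_upwards [hF.coeFn_toLp] with x hx
  simp [hx, sq]

theorem MeasureTheory.MemLp.inner_toLp {F G : A → ℝ} (hF : MemLp F 2 α) (hG : MemLp G 2 α) :
    inner ℝ hF.toLp hG.toLp = ∫ x, F x * G x ∂α := by
  rw [L2.inner_def]
  refine integral_congr_ae ?_
  filter_upwards [hF.coeFn_toLp, hG.coeFn_toLp] with x hx hy
  simp [hx, hy, mul_comm]

theorem MeasureTheory.MemLp.integral_mul_le {F G : A → ℝ} (hF : MemLp F 2 α) (hG : MemLp G 2 α) :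
    ∫ x, F x * G x ∂α ≤ √(∫ x, F x ^ 2 ∂α) * √(∫ x, G x ^ 2 ∂α) := by
  rw [← hF.inner_toLp hG, ← hF.norm_toLp_eq_sqrt, ← hG.norm_toLp_eq_sqrt]
  exact real_inner_le_norm _ _

end Fibre

/-! ### Maximal correlation and its tensorisation -/

section MaximalCorrelation

variable {Ω A B Ω' A' B' : Type*} [MeasurableSpace Ω] [MeasurableSpace A] [MeasurableSpace B]
  [MeasurableSpace Ω'] [MeasurableSpace A'] [MeasurableSpace B']
  {μ : Measure Ω} {α : Measure A} {β : Measure B}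
  {μ' : Measure Ω'} {α' : Measure A'} {β' : Measure B'}

/-- The maximal correlation of `a : Ω → A` and `b : Ω → B`, with laws `α` and `β`, is at
most `c`. -/
def MaxCorrLE (μ : Measure Ω) (α : Measure A) (β : Measure B) (a : Ω → A) (b : Ω → B) (c : ℝ) :
    Prop :=
  ∀ (F : A → ℝ) (G : B → ℝ), MemLp F 2 α → MemLp G 2 β → ∫ x, F x ∂α = 0 → ∫ y, G y ∂β = 0 →
    |∫ ω, F (a ω) * G (b ω) ∂μ| ≤ c * (√(∫ x, F x ^ 2 ∂α) * √(∫ y, G y ^ 2 ∂β))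

/-- The uncentred form is what the product argument needs: restrictions to fibres of a mean-zero
function do not have mean zero. -/
theorem MaxCorrLE.abs_covariance_le [IsProbabilityMeasure μ] [IsProbabilityMeasure α]
    [IsProbabilityMeasure β] {a : Ω → A} {b : Ω → B} {c : ℝ} (h : MaxCorrLE μ α β a b c)
    (ha : MeasurePreserving a μ α) (hb : MeasurePreserving b μ β) {F : A → ℝ} {G : B → ℝ}
    (hF : MemLp F 2 α) (hG : MemLp G 2 β) :
    |∫ ω, F (a ω) * G (b ω) ∂μ - (∫ x, F x ∂α) * ∫ y, G y ∂β| ≤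
      c * (√(∫ x, F x ^ 2 ∂α - (∫ x, F x ∂α) ^ 2) * √(∫ y, G y ^ 2 ∂β - (∫ y, G y ∂β) ^ 2)) := by
  set f := ∫ x, F x ∂α with hf
  set g := ∫ y, G y ∂β with hg
  have iF : Integrable F α := hF.integrable (by norm_num)
  have iG : Integrable G β := hG.integrable (by norm_num)
  have h1 := h (fun x => F x - f) (fun y => G y - g) (hF.sub (memLp_const f))
    (hG.sub (memLp_const g)) (by rw [integral_sub iF (integrable_const _)]; simp [hf])
    (by rw [integral_sub iG (integrable_const _)]; simp [hg])
  rw [integral_sub_integral_sq hF, integral_sub_integral_sq hG] at h1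
  have iFa : Integrable (fun ω => F (a ω)) μ := ha.integrable_comp_of_integrable iF
  have iGb : Integrable (fun ω => G (b ω)) μ := hb.integrable_comp_of_integrable iG
  have iFG : Integrable (fun ω => F (a ω) * G (b ω)) μ :=
    (hF.comp_measurePreserving ha).integrable_mul (hG.comp_measurePreserving hb)
  have e1 : ∫ ω, F (a ω) ∂μ = f := by
    rw [hf, ← ha.map_eq, integral_map ha.aemeasurable (by rw [ha.map_eq]; exact hF.1)]
  have e2 : ∫ ω, G (b ω) ∂μ = g := by
    rw [hg, ← hb.map_eq, integral_map hb.aemeasurable (by rw [hb.map_eq]; exact hG.1)]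
  convert h1 using 2
  have : ∀ ω, (F (a ω) - f) * (G (b ω) - g) =
      F (a ω) * G (b ω) - g * F (a ω) - f * G (b ω) + f * g := fun ω => by ring
  simp_rw [this]
  have h2 : Integrable (fun ω => F (a ω) * G (b ω) - g * F (a ω)) μ := iFG.sub (iFa.const_mul _)
  have h3 : Integrable (fun ω => F (a ω) * G (b ω) - g * F (a ω) - f * G (b ω)) μ :=
    h2.sub (iGb.const_mul _)
  rw [integral_add h3 (integrable_const _), integral_sub h2 (iGb.const_mul _),
    integral_sub iFG (iFa.const_mul _), integral_const_mul, integral_const_mul, e1, e2]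
  simp; ring

/-- Cauchy–Schwarz in `ℝ²`; it recombines the two levels of a variance decomposition. -/
theorem add_sqrt_le_sqrt {x y z w : ℝ} (hx : 0 ≤ x) (hy : 0 ≤ y) (hz : 0 ≤ z) (hw : 0 ≤ w) :
    √x * √y + √z * √w ≤ √(x + z) * √(y + w) := by
  rw [← Real.sqrt_mul (x := x + z) (by positivity)]
  refine Real.le_sqrt_of_sq_le ?_
  have h1 := Real.sq_sqrt hx
  have h2 := Real.sq_sqrt hy
  have h3 := Real.sq_sqrt hz
  have h4 := Real.sq_sqrt hw
  calc (√x * √y + √z * √w) ^ 2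
      = √x ^ 2 * √y ^ 2 + √z ^ 2 * √w ^ 2 + 2 * ((√x * √w) * (√z * √y)) := by ring
    _ ≤ √x ^ 2 * √y ^ 2 + √z ^ 2 * √w ^ 2 + ((√x * √w) ^ 2 + (√z * √y) ^ 2) := by
        have := two_mul_le_add_sq (√x * √w) (√z * √y)
        linarith
    _ = (√x ^ 2 + √z ^ 2) * (√y ^ 2 + √w ^ 2) := by ring
    _ = (x + z) * (y + w) := by rw [h1, h2, h3, h4]

theorem memLp_sqrt {V : A → ℝ} (hV : Integrable V α) (h0 : 0 ≤ᵐ[α] V) :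
    MemLp (fun x => √(V x)) 2 α ∧ ∫ x, √(V x) ^ 2 ∂α = ∫ x, V x ∂α := by
  have e : (fun x => √(V x) ^ 2) =ᵐ[α] V := by
    filter_upwards [h0] with x hx using Real.sq_sqrt hx
  refine ⟨?_, integral_congr_ae e⟩
  rw [memLp_two_iff_integrable_sq (Real.continuous_sqrt.comp_aestronglyMeasurable hV.1)]
  exact hV.congr e.symm

/-- Given `ω`, the fibres of `F` and `G` have covariance at most `c` times the product of their
standard deviations `√VF`, `√VG`, by `h'`. Integrating with Cauchy–Schwarz bounds the fluctuating
part, and `h` bounds the correlation of the fibre means `f`, `g`. Since the squared norm is that of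
the fibre mean plus the mean fibre variance, the two bounds add up with the same `c`. -/
theorem MaxCorrLE.prod [IsProbabilityMeasure μ] [IsProbabilityMeasure α] [IsProbabilityMeasure β]
    [IsProbabilityMeasure μ'] [IsProbabilityMeasure α'] [IsProbabilityMeasure β']
    {a : Ω → A} {b : Ω → B} {a' : Ω' → A'} {b' : Ω' → B'} {c : ℝ} (hc : 0 ≤ c)
    (h : MaxCorrLE μ α β a b c) (h' : MaxCorrLE μ' α' β' a' b' c)
    (ha : MeasurePreserving a μ α) (hb : MeasurePreserving b μ β)
    (ha' : MeasurePreserving a' μ' α') (hb' : MeasurePreserving b' μ' β') :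
    MaxCorrLE (μ.prod μ') (α.prod α') (β.prod β') (Prod.map a a') (Prod.map b b') c := by
  intro F G hF hG hF0 hG0
  let f : A → ℝ := fun x => ∫ x', F (x, x') ∂α'
  let g : B → ℝ := fun y => ∫ y', G (y, y') ∂β'
  let VF : A → ℝ := fun x => ∫ x', F (x, x') ^ 2 ∂α' - f x ^ 2
  let VG : B → ℝ := fun y => ∫ y', G (y, y') ^ 2 ∂β' - g y ^ 2
  have hf : MemLp f 2 α := hF.integral_fibre
  have hg : MemLp g 2 β := hG.integral_fibre
  have iVF : Integrable VF α := hF.integrable_sq.integral_prod_left.sub hf.integrable_sq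
  have iVG : Integrable VG β := hG.integrable_sq.integral_prod_left.sub hg.integrable_sq
  have VF0 : 0 ≤ᵐ[α] VF := by
    filter_upwards [hF.ae_fibre] with x hx
    exact sub_nonneg.2 (sq_integral_le_integral_sq hx)
  have VG0 : 0 ≤ᵐ[β] VG := by
    filter_upwards [hG.ae_fibre] with x hx
    exact sub_nonneg.2 (sq_integral_le_integral_sq hx)
  have f0 : ∫ x, f x ∂α = 0 := by
    rw [← hF0, integral_prod _ (hF.integrable (by norm_num))]
  have g0 : ∫ x, g x ∂β = 0 := by
    rw [← hG0, integral_prod _ (hG.integrable (by norm_num))]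
  have eF : ∫ z, F z ^ 2 ∂(α.prod α') = ∫ x, f x ^ 2 ∂α + ∫ x, VF x ∂α := by
    rw [integral_prod _ hF.integrable_sq,
      integral_sub hF.integrable_sq.integral_prod_left hf.integrable_sq]
    ring
  have eG : ∫ z, G z ^ 2 ∂(β.prod β') = ∫ x, g x ^ 2 ∂β + ∫ x, VG x ∂β := by
    rw [integral_prod _ hG.integrable_sq,
      integral_sub hG.integrable_sq.integral_prod_left hg.integrable_sq]
    ring
  obtain ⟨mVF, eVF⟩ := memLp_sqrt iVF VF0
  obtain ⟨mVG, eVG⟩ := memLp_sqrt iVG VG0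
  have iH : Integrable (fun z : Ω × Ω' => F (Prod.map a a' z) * G (Prod.map b b' z))
      (μ.prod μ') :=
    (hF.comp_measurePreserving (ha.prod ha')).integrable_mul
      (hG.comp_measurePreserving (hb.prod hb'))
  let J : Ω → ℝ := fun ω => ∫ ω', F (a ω, a' ω') * G (b ω, b' ω') ∂μ'
  have iJ : Integrable J μ := iH.integral_prod_left
  have ifg : Integrable (fun ω => f (a ω) * g (b ω)) μ :=
    (hf.comp_measurePreserving ha).integrable_mul (hg.comp_measurePreserving hb)
  have mVFa := mVF.comp_measurePreserving ha
  have mVGb := mVG.comp_measurePreserving hb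
  have iV : Integrable (fun ω => √(VF (a ω)) * √(VG (b ω))) μ := mVFa.integrable_mul mVGb
  have hJ : ∀ᵐ ω ∂μ, |J ω - f (a ω) * g (b ω)| ≤ c * (√(VF (a ω)) * √(VG (b ω))) := by
    filter_upwards [ha.quasiMeasurePreserving.ae hF.ae_fibre,
      hb.quasiMeasurePreserving.ae hG.ae_fibre] with ω h1 h2
    exact h'.abs_covariance_le ha' hb' h1 h2
  have hrem : |∫ ω, (J ω - f (a ω) * g (b ω)) ∂μ| ≤
      c * (√(∫ x, VF x ∂α) * √(∫ x, VG x ∂β)) := by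
    calc _ ≤ ∫ ω, c * (√(VF (a ω)) * √(VG (b ω))) ∂μ :=
          (abs_integral_le_integral_abs).trans
            (integral_mono_ae (iJ.sub ifg).abs (iV.const_mul _) hJ)
      _ = c * ∫ ω, √(VF (a ω)) * √(VG (b ω)) ∂μ := integral_const_mul _ _
      _ ≤ c * (√(∫ ω, √(VF (a ω)) ^ 2 ∂μ) * √(∫ ω, √(VG (b ω)) ^ 2 ∂μ)) :=
          mul_le_mul_of_nonneg_left (mVFa.integral_mul_le mVGb) hc
      _ = _ := by
          rw [← eVF, ← eVG, ← ha.map_eq, ← hb.map_eq,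
            integral_map ha.aemeasurable (by rw [ha.map_eq]; exact mVF.1.pow 2),
            integral_map hb.aemeasurable (by rw [hb.map_eq]; exact mVG.1.pow 2)]
  have hmain := h f g hf hg f0 g0
  have e0 : ∫ z, F (Prod.map a a' z) * G (Prod.map b b' z) ∂(μ.prod μ') =
      ∫ ω, f (a ω) * g (b ω) ∂μ + ∫ ω, (J ω - f (a ω) * g (b ω)) ∂μ := by
    rw [integral_prod _ iH, integral_sub iJ ifg]
    simp only [Prod.map]
    ring
  rw [e0, eF, eG]
  calc _ ≤ |∫ ω, f (a ω) * g (b ω) ∂μ| + |∫ ω, (J ω - f (a ω) * g (b ω)) ∂μ| := abs_add_le _ _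
    _ ≤ c * (√(∫ x, f x ^ 2 ∂α) * √(∫ x, g x ^ 2 ∂β)) +
        c * (√(∫ x, VF x ∂α) * √(∫ x, VG x ∂β)) := add_le_add hmain hrem
    _ = c * (√(∫ x, f x ^ 2 ∂α) * √(∫ x, g x ^ 2 ∂β) +
        √(∫ x, VF x ∂α) * √(∫ x, VG x ∂β)) := by ring
    _ ≤ _ := mul_le_mul_of_nonneg_left (add_sqrt_le_sqrt
        (integral_nonneg fun _ => sq_nonneg _) (integral_nonneg fun _ => sq_nonneg _)
        (integral_nonneg_of_ae VF0) (integral_nonneg_of_ae VG0)) hc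

theorem MaxCorrLE.pi [IsProbabilityMeasure μ] [IsProbabilityMeasure α] [IsProbabilityMeasure β]
    {a : Ω → A} {b : Ω → B} {c : ℝ} (hc : 0 ≤ c) (h : MaxCorrLE μ α β a b c)
    (ha : MeasurePreserving a μ α) (hb : MeasurePreserving b μ β) (n : ℕ) :
    MaxCorrLE (Measure.pi fun _ : Fin n => μ) (Measure.pi fun _ => α) (Measure.pi fun _ => β)
      (fun ω i => a (ω i)) (fun ω i => b (ω i)) c := by
  induction n with
  -- On a one-point space a function of mean zero vanishes.
  | zero =>
    intro F G hF hG hF0 hG0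
    have : F = 0 := by
      funext x
      rw [Measure.pi_of_empty (fun _ : Fin 0 => α), integral_dirac' _ _ (.of_discrete)] at hF0
      rw [Subsingleton.elim x isEmptyElim, hF0]; rfl
    simp [this]
  | succ n ih =>
    have hp := h.prod hc ih ha hb (measurePreserving_pi _ _ fun _ => ha)
      (measurePreserving_pi _ _ fun _ => hb)
    have eA := measurePreserving_piFinSuccAbove (fun _ : Fin (n + 1) => α) 0
    have eB := measurePreserving_piFinSuccAbove (fun _ : Fin (n + 1) => β) 0
    have eΩ := measurePreserving_piFinSuccAbove (fun _ : Fin (n + 1) => μ) 0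
    intro F G hF hG hF0 hG0
    have h1 := hp _ _ (hF.comp_measurePreserving eA.symm) (hG.comp_measurePreserving eB.symm)
      (by rw [← hF0]; exact eA.symm.integral_comp' F) (by rw [← hG0]; exact eB.symm.integral_comp' G)
    have i1 := eA.symm.integral_comp' fun x => F x ^ 2
    have i2 := eB.symm.integral_comp' fun x => G x ^ 2
    have i3 := eΩ.integral_comp' fun z => F ((MeasurableEquiv.piFinSuccAbove (fun _ => A) 0).symm
      (Prod.map a (fun ω i => a (ω i)) z)) * G ((MeasurableEquiv.piFinSuccAbove (fun _ => B) 0).symm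
      (Prod.map b (fun ω i => b (ω i)) z))
    simp only [Function.comp_apply] at h1
    rw [i1, i2, ← i3] at h1
    convert h1 using 2
    refine integral_congr_ae (.of_forall fun ω => ?_)
    have hA : (fun i => a (ω i)) = (MeasurableEquiv.piFinSuccAbove (fun _ => A) 0).symm
        (Prod.map a (fun ω i => a (ω i)) (MeasurableEquiv.piFinSuccAbove (fun _ => Ω) 0 ω)) := by
      rw [MeasurableEquiv.eq_symm_apply]; rfl
    have hB : (fun i => b (ω i)) = (MeasurableEquiv.piFinSuccAbove (fun _ => B) 0).symm
        (Prod.map b (fun ω i => b (ω i)) (MeasurableEquiv.piFinSuccAbove (fun _ => Ω) 0 ω)) := by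
      rw [MeasurableEquiv.eq_symm_apply]; rfl
    change F _ * G _ = F _ * G _
    rw [← hA, ← hB]

end MaximalCorrelation

/-! ### Uniform measure of the sphere: isometry invariance and latitude coordinates -/

namespace RoundSphere

variable {d : ℕ}

/-- The point of the sphere with a given coordinate vector of norm one. -/
def ofCoords (v : EuclideanSpace ℝ (Fin (d + 1))) (hv : ‖v‖ = 1) : RoundSphere d :=
  ⟨v, mem_sphere_zero_iff_norm.2 hv⟩

@[simp]
theorem coords_ofCoords (v : EuclideanSpace ℝ (Fin (d + 1))) (hv : ‖v‖ = 1) :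
    (ofCoords v hv).coords = v := rfl

theorem measurable_coords : Measurable (coords (d := d)) := measurable_subtype_coe

theorem measurable_of_coords {A : Type*} [MeasurableSpace A] {f : A → RoundSphere d}
    (hf : Measurable fun a => (f a).coords) : Measurable f := by
  intro s hs
  obtain ⟨u, hu, rfl⟩ := hs
  exact hf hu

/-- The first point of the standard frame. -/
noncomputable def north (d : ℕ) : RoundSphere d :=
  ofCoords (EuclideanSpace.single 0 1) (by simp)

/-- The radial projection onto the sphere. -/
noncomputable def normalize (v : EuclideanSpace ℝ (Fin (d + 1))) : RoundSphere d :=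
  if h : v = 0 then north d else ofCoords (‖v‖⁻¹ • v) (by
    rw [norm_smul, norm_inv, norm_norm, inv_mul_cancel₀ (norm_ne_zero_iff.2 h)])

theorem coords_normalize {v : EuclideanSpace ℝ (Fin (d + 1))} (h : v ≠ 0) :
    (normalize v).coords = ‖v‖⁻¹ • v := by
  simp [normalize, h]

theorem normalize_smul_coords {r : ℝ} (hr : 0 < r) (y : RoundSphere d) :
    normalize (r • y.coords) = y := by
  apply coords_injective
  rw [coords_normalize (smul_ne_zero hr.ne' (coords_ne_zero y)), norm_smul, norm_coords,
    Real.norm_of_nonneg hr.le, mul_one, smul_smul, inv_mul_cancel₀ hr.ne', one_smul]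

theorem measurable_normalize : Measurable (normalize (d := d)) := by
  apply measurable_of_coords
  have : (fun v => (normalize (d := d) v).coords) =
      fun v => if v = 0 then (north d).coords else ‖v‖⁻¹ • v := by
    funext v
    by_cases h : v = 0
    · simp [h, normalize]
    · simp [h, coords_normalize h]
  rw [this]
  exact Measurable.ite (measurableSet_singleton _) measurable_const
    (measurable_norm.inv.smul measurable_id)

/-- The cone over `s` in the definition of `toSphere` is the preimage of `s` under radial
projection, up to the null set `{0}`. Facts about Lebesgue measure on the ball thereby transfer to
the sphere. -/
theorem areaMeasure_eq_map (d : ℕ) : areaMeasure d = ((d + 1 : ℕ) : ℝ≥0∞) •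
    ((volume : Measure (EuclideanSpace ℝ (Fin (d + 1)))).restrict (Metric.ball 0 1)).map
      normalize := by
  ext s hs
  rw [Measure.smul_apply, Measure.map_apply measurable_normalize hs,
    Measure.restrict_apply (measurable_normalize hs), smul_eq_mul]
  refine (Measure.toSphere_apply' _ hs).trans ?_
  rw [finrank_euclideanSpace_fin, ← measure_sdiff_null (s := normalize ⁻¹' s ∩ Metric.ball 0 1)
    (measure_singleton (0 : EuclideanSpace ℝ (Fin (d + 1))))]
  congr 2
  ext v
  simp only [Set.mem_smul, Set.mem_sdiff, Set.mem_inter_iff, Set.mem_preimage,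
    mem_ball_zero_iff, Set.mem_singleton_iff]
  constructor
  · rintro ⟨r, ⟨hr, hr1⟩, _, ⟨y, hy, rfl⟩, rfl⟩
    have h1 : normalize (r • y.1) = y := normalize_smul_coords hr y
    have h2 : ‖y.1‖ = 1 := norm_coords y
    refine ⟨⟨?_, ?_⟩, smul_ne_zero hr.ne' (coords_ne_zero y)⟩
    · rw [h1]; exact hy
    · rw [norm_smul, h2, Real.norm_of_nonneg hr.le, mul_one]; exact hr1
  · rintro ⟨⟨h1, h2⟩, h3⟩
    refine ⟨‖v‖, ⟨norm_pos_iff.2 h3, h2⟩, _, ⟨normalize v, h1, rfl⟩, ?_⟩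
    change ‖v‖ • (normalize v).coords = v
    rw [coords_normalize h3, smul_smul, mul_inv_cancel₀ (norm_ne_zero_iff.2 h3), one_smul]

/-- The action of a linear isometry on the sphere. -/
noncomputable def isometryMap (U : EuclideanSpace ℝ (Fin (d + 1)) ≃ₗᵢ[ℝ] EuclideanSpace ℝ (Fin (d + 1)))
    (x : RoundSphere d) : RoundSphere d :=
  ofCoords (U x.coords) (by rw [U.norm_map, norm_coords])

/-- A linear isometry preserves Lebesgue measure on the ball and commutes with radial projection
away from the origin. -/
theorem measurePreserving_isometryMap
    (U : EuclideanSpace ℝ (Fin (d + 1)) ≃ₗᵢ[ℝ] EuclideanSpace ℝ (Fin (d + 1))) :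
    MeasurePreserving (isometryMap U) (uniformMeasure d) (uniformMeasure d) := by
  have hm : Measurable (isometryMap U) :=
    measurable_of_coords (U.continuous.measurable.comp measurable_coords)
  refine ⟨hm, ?_⟩
  have hU := (U.measurePreserving.restrict_preimage
    (Metric.isOpen_ball (x := (0 : EuclideanSpace ℝ (Fin (d + 1)))) (ε := 1)).measurableSet)
  have hb : U ⁻¹' Metric.ball 0 1 = Metric.ball 0 1 := by
    ext v; simp
  rw [hb] at hU
  rw [uniformMeasure, Measure.map_smul]
  congr 1
  rw [areaMeasure_eq_map, Measure.map_smul]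
  congr 1
  rw [Measure.map_map hm measurable_normalize]
  nth_rw 2 [← hU.map_eq]
  rw [Measure.map_map measurable_normalize U.continuous.measurable]
  refine Measure.map_congr (ae_restrict_of_ae ?_)
  filter_upwards [compl_mem_ae_iff.2 (measure_singleton (0 : EuclideanSpace ℝ (Fin (d + 1))))]
    with v hv
  have hv' : v ≠ 0 := hv
  apply coords_injective
  change U (normalize v).coords = (normalize (U v)).coords
  rw [coords_normalize hv', coords_normalize (by simpa using hv'), map_smul, U.norm_map]

/-- Prepend a coordinate. -/
noncomputable def consVec (p : ℝ × EuclideanSpace ℝ (Fin (d + 1))) : EuclideanSpace ℝ (Fin (d + 2)) :=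
  WithLp.toLp 2 (Fin.cons p.1 p.2.ofLp : Fin (d + 2) → ℝ)

theorem inner_consVec (p q : ℝ × EuclideanSpace ℝ (Fin (d + 1))) :
    inner ℝ (consVec p) (consVec q) = p.1 * q.1 + inner ℝ p.2 q.2 := by
  simp [consVec, PiLp.inner_apply, Fin.sum_univ_succ, mul_comm]

theorem norm_consVec_sq (p : ℝ × EuclideanSpace ℝ (Fin (d + 1))) :
    ‖consVec p‖ ^ 2 = p.1 ^ 2 + ‖p.2‖ ^ 2 := by
  rw [← real_inner_self_eq_norm_sq, inner_consVec, real_inner_self_eq_norm_sq]; ring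

theorem consVec_sub (p q : ℝ × EuclideanSpace ℝ (Fin (d + 1))) :
    consVec p - consVec q = consVec (p - q) := by
  ext i
  refine Fin.cases ?_ (fun j => ?_) i <;> simp [consVec]

theorem consVec_smul (c : ℝ) (p : ℝ × EuclideanSpace ℝ (Fin (d + 1))) :
    c • consVec p = consVec (c • p) := by
  ext i
  refine Fin.cases ?_ (fun j => ?_) i <;> simp [consVec]

theorem measurePreserving_consVec : MeasurePreserving (consVec (d := d)) := by
  have h1 : MeasurePreserving (Prod.map (id : ℝ → ℝ)
      (WithLp.ofLp : EuclideanSpace ℝ (Fin (d + 1)) → Fin (d + 1) → ℝ)) :=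
    (MeasurePreserving.id volume).prod (PiLp.volume_preserving_ofLp _)
  have h2 := (volume_preserving_piFinSuccAbove (fun _ : Fin (d + 2) => ℝ) 0).symm
  have h3 := (PiLp.volume_preserving_toLp (Fin (d + 2))).comp (h2.comp h1)
  convert h3 using 1
  funext p
  refine congrArg (WithLp.toLp 2) (funext fun i => ?_)
  refine Fin.cases ?_ (fun j => ?_) i <;> rfl

/-- Polar coordinates; `Measure.volumeIoiPow d` has density `r^d`, and the origin is negligible. -/
theorem measurePreserving_polar (d : ℕ) :
    MeasurePreserving (fun p : RoundSphere d × Set.Ioi (0 : ℝ) => p.2.1 • p.1.coords)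
      ((areaMeasure d).prod (Measure.volumeIoiPow d)) volume := by
  have h1 := (volume : Measure (EuclideanSpace ℝ (Fin (d + 1)))
    ).measurePreserving_homeomorphUnitSphereProd
  rw [finrank_euclideanSpace_fin, Nat.add_sub_cancel] at h1
  have h2 := MeasurePreserving.symm
    (homeomorphUnitSphereProd (EuclideanSpace ℝ (Fin (d + 1)))).toMeasurableEquiv h1
  have h3 : MeasurePreserving (Subtype.val : ({0}ᶜ : Set (EuclideanSpace ℝ (Fin (d + 1)))) → _)
      ((volume : Measure (EuclideanSpace ℝ (Fin (d + 1)))).comap Subtype.val) volume := by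
    refine ⟨measurable_subtype_coe, ?_⟩
    rw [(MeasurableEmbedding.subtype_coe (measurableSet_singleton _).compl).map_comap,
      Subtype.range_coe, Measure.restrict_eq_self_of_ae_mem]
    exact compl_mem_ae_iff.2 (measure_singleton _)
  exact h3.comp h2

/-- The point of `S^(d+1)` at height `t` over the point `y` of the equator. -/
noncomputable def join (p : Set.Icc (-1 : ℝ) 1 × RoundSphere d) : RoundSphere (d + 1) :=
  ofCoords (consVec (p.1.1, √(1 - p.1.1 ^ 2) • p.2.coords)) (by
    have h : 0 ≤ 1 - p.1.1 ^ 2 := by nlinarith [p.1.2.1, p.1.2.2]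
    rw [← sq_eq_sq₀ (norm_nonneg _) zero_le_one, norm_consVec_sq, norm_smul, norm_coords, mul_one,
      Real.norm_of_nonneg (Real.sqrt_nonneg _), Real.sq_sqrt h]
    ring)

theorem measurable_join : Measurable (join (d := d)) := by
  apply measurable_of_coords
  refine measurePreserving_consVec.measurable.comp (Measurable.prodMk
    (measurable_subtype_coe.comp measurable_fst) ?_)
  exact Measurable.smul
    ((measurable_const.sub ((measurable_subtype_coe.comp measurable_fst).pow_const 2)).sqrt) (measurable_coords.comp measurable_snd)

/-- The height of the direction `(s, r)` in the half plane `r > 0`. -/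
noncomputable def height (p : ℝ × Set.Ioi (0 : ℝ)) : Set.Icc (-1 : ℝ) 1 :=
  ⟨p.1 / √(p.1 ^ 2 + p.2.1 ^ 2), by
    have h : |p.1| ≤ √(p.1 ^ 2 + p.2.1 ^ 2) := Real.abs_le_sqrt (by nlinarith [sq_nonneg p.2.1])
    rw [Set.mem_Icc, ← abs_le, abs_div, abs_of_nonneg (Real.sqrt_nonneg _)]
    exact div_le_one_of_le₀ h (Real.sqrt_nonneg _)⟩

theorem measurable_height : Measurable height := by
  refine Measurable.subtype_mk ?_
  fun_prop

theorem normalize_consVec_smul (p : (ℝ × Set.Ioi (0 : ℝ)) × RoundSphere d) :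
    normalize (consVec (p.1.1, p.1.2.1 • p.2.coords)) = join (height p.1, p.2) := by
  obtain ⟨⟨s, r, hr⟩, y⟩ := p
  have hr : 0 < r := hr
  have hpos : 0 < s ^ 2 + r ^ 2 := by positivity
  have hn : ‖consVec (s, r • y.coords)‖ = √(s ^ 2 + r ^ 2) := by
    rw [eq_comm, Real.sqrt_eq_iff_mul_self_eq hpos.le (norm_nonneg _), ← sq, norm_consVec_sq,
      norm_smul, norm_coords, mul_one, Real.norm_eq_abs, sq_abs]
  have hs : √(1 - (s / √(s ^ 2 + r ^ 2)) ^ 2) = r / √(s ^ 2 + r ^ 2) := by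
    rw [Real.sqrt_eq_iff_mul_self_eq _ (by positivity), ← sq, div_pow, div_pow,
      Real.sq_sqrt hpos.le]
    · field_simp; ring
    · rw [div_pow, Real.sq_sqrt hpos.le, sub_nonneg, div_le_one hpos]; nlinarith
  apply coords_injective
  rw [coords_normalize (by rw [← norm_ne_zero_iff]; rw [hn]; positivity), hn, consVec_smul]
  simp only [join, height, coords_ofCoords, hs, Prod.smul_mk, smul_smul, smul_eq_mul]
  congr 2
  · ring
  · congr 1; ring

theorem areaMeasure_univ (d : ℕ) :
    areaMeasure d Set.univ ≠ 0 ∧ areaMeasure d Set.univ ≠ ∞ := by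
  have : IsFiniteMeasure (areaMeasure d) := inferInstanceAs
    (IsFiniteMeasure ((volume : Measure (EuclideanSpace ℝ (Fin (d + 1)))).toSphere))
  refine ⟨?_, measure_ne_top _ _⟩
  rw [Ne, Measure.measure_univ_eq_zero]
  exact Measure.toSphere_ne_zero _

/-- Latitudes and the equatorial point are independent under the uniform measure. -/
theorem exists_measurePreserving_join (d : ℕ) :
    ∃ ν : Measure (Set.Icc (-1 : ℝ) 1), IsProbabilityMeasure ν ∧
      MeasurePreserving join (ν.prod (uniformMeasure d)) (uniformMeasure (d + 1)) := by
  have : IsFiniteMeasure (areaMeasure d) := inferInstanceAs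
    (IsFiniteMeasure ((volume : Measure (EuclideanSpace ℝ (Fin (d + 1)))).toSphere))
  -- Split `ℝ^(d+2) = ℝ × ℝ^(d+1)` and use polar coordinates in the second factor only. Both the
  -- unit ball and the height of the direction of `(s, r • y)` depend on `(s, r)` alone, so
  -- projecting the ball leaves a product measure.
  let l : Measure (ℝ × Set.Ioi (0 : ℝ)) := (volume : Measure ℝ).prod (Measure.volumeIoiPow d)
  have h1 : MeasurePreserving
      (fun p : (ℝ × Set.Ioi (0 : ℝ)) × RoundSphere d => consVec (p.1.1, p.1.2.1 • p.2.coords))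
      (l.prod (areaMeasure d)) volume := by
    have a1 := measurePreserving_prodAssoc (volume : Measure ℝ) (Measure.volumeIoiPow d)
      (areaMeasure d)
    have a2 := (MeasurePreserving.id (volume : Measure ℝ)).prod
      (Measure.measurePreserving_swap (μ := Measure.volumeIoiPow d) (ν := areaMeasure d))
    have a3 := (MeasurePreserving.id (volume : Measure ℝ)).prod (measurePreserving_polar d)
    exact measurePreserving_consVec.comp (a3.comp (a2.comp a1))
  let D : Set (ℝ × Set.Ioi (0 : ℝ)) := {p | p.1 ^ 2 + p.2.1 ^ 2 < 1}
  have h2 := h1.restrict_preimage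
    (Metric.isOpen_ball (x := (0 : EuclideanSpace ℝ (Fin (d + 2)))) (ε := 1)).measurableSet
  have hD : (fun p : (ℝ × Set.Ioi (0 : ℝ)) × RoundSphere d =>
      consVec (p.1.1, p.1.2.1 • p.2.coords)) ⁻¹' Metric.ball 0 1 = D ×ˢ Set.univ := by
    ext p
    have : ‖consVec (p.1.1, p.1.2.1 • p.2.coords)‖ ^ 2 = p.1.1 ^ 2 + p.1.2.1 ^ 2 := by
      rw [norm_consVec_sq, norm_smul, norm_coords, mul_one, Real.norm_eq_abs, sq_abs]
    simp only [Set.mem_preimage, mem_ball_zero_iff, Set.mem_prod, Set.mem_univ, and_true]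
    rw [← sq_lt_one_iff₀ (norm_nonneg _), this]
    rfl
  rw [hD, ← Measure.prod_restrict, Measure.restrict_univ] at h2
  have h3 : areaMeasure (d + 1) = ((d + 1 + 1 : ℕ) : ℝ≥0∞) •
      ((((l.restrict D).map height).prod (areaMeasure d)).map join) := by
    rw [areaMeasure_eq_map, ← h2.map_eq, Measure.map_map measurable_normalize h2.measurable]
    congr 1
    have : normalize ∘ (fun p : (ℝ × Set.Ioi (0 : ℝ)) × RoundSphere d =>
        consVec (p.1.1, p.1.2.1 • p.2.coords)) = join ∘ Prod.map height id :=
      funext normalize_consVec_smul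
    rw [this, ← Measure.map_map measurable_join (measurable_height.prodMap measurable_id),
      ← Measure.map_prod_map _ _ measurable_height measurable_id, Measure.map_id]
  obtain ⟨a0, a1⟩ := areaMeasure_univ d
  have h4 : areaMeasure d = areaMeasure d Set.univ • uniformMeasure d := by
    rw [uniformMeasure, smul_smul, ENNReal.mul_inv_cancel a0 a1, one_smul]
  -- The factor collects the normalisations of both spheres and the `d + 2` of `areaMeasure_eq_map`.
  -- It is never evaluated: that `ν` has mass one is read off from `h5`.
  let ν : Measure (Set.Icc (-1 : ℝ) 1) := ((areaMeasure (d + 1) Set.univ)⁻¹ *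
    ((d + 1 + 1 : ℕ) : ℝ≥0∞) * areaMeasure d Set.univ) • (l.restrict D).map height
  have h5 : MeasurePreserving join (ν.prod (uniformMeasure d)) (uniformMeasure (d + 1)) := by
    refine ⟨measurable_join, ?_⟩
    have h6 : ((l.restrict D).map height).prod (areaMeasure d) =
        areaMeasure d Set.univ • ((l.restrict D).map height).prod (uniformMeasure d) := by
      conv_lhs => rw [h4, Measure.prod_smul_right]
    have h7 : uniformMeasure (d + 1) =
        (areaMeasure (d + 1) Set.univ)⁻¹ • areaMeasure (d + 1) := rfl
    rw [h6, Measure.map_smul, smul_smul] at h3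
    conv_rhs => rw [h7, h3]
    rw [Measure.prod_smul_left, Measure.map_smul, smul_smul, mul_assoc, ← h3]
  refine ⟨ν, ⟨?_⟩, h5⟩
  have h8 := h5.measure_preimage MeasurableSet.univ.nullMeasurableSet
  rwa [Set.preimage_univ, measure_univ (μ := uniformMeasure (d + 1)), ← Set.univ_prod_univ,
    Measure.prod_prod, measure_univ (μ := uniformMeasure d), mul_one] at h8

end RoundSphere

/-! ### Polynomials in `L²` of an interval and correlation by conditional moments -/

section Polynomial

variable {Ω : Type*} [MeasurableSpace Ω] {μ : Measure Ω} {x y : ℝ} {ν : Measure (Set.Icc x y)}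

theorem memLp_polynomial_eval [IsFiniteMeasure ν] (p : Polynomial ℝ) :
    MemLp (fun t : Set.Icc x y => p.eval t.1) 2 ν := by
  have hc : Continuous fun t : Set.Icc x y => p.eval t.1 := p.continuous.comp continuous_subtype_val
  obtain ⟨C, hC⟩ := isCompact_univ.exists_bound_of_continuousOn hc.continuousOn
  exact MemLp.of_bound hc.aestronglyMeasurable C (.of_forall fun t => hC t trivial)

/-- The class in `L²` of a polynomial function. -/
noncomputable def polynomialLp (ν : Measure (Set.Icc x y)) [IsFiniteMeasure ν] :
    Polynomial ℝ →ₗ[ℝ] Lp ℝ 2 ν :=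
  (ContinuousMap.toLp 2 ν ℝ).toLinearMap ∘ₗ
    (Polynomial.toContinuousMapOnAlgHom (Set.Icc x y)).toLinearMap

theorem polynomialLp_eq_toLp [IsFiniteMeasure ν] (p : Polynomial ℝ) :
    polynomialLp ν p = (memLp_polynomial_eval p).toLp := by
  apply Lp.ext
  refine (ContinuousMap.coeFn_toLp (p := 2) (𝕜 := ℝ) ν
    (Polynomial.toContinuousMapOnAlgHom (Set.Icc x y) p)).trans ?_
  exact (memLp_polynomial_eval p).coeFn_toLp.symm

theorem polynomialLp_mem_span [IsFiniteMeasure ν] {p : Polynomial ℝ} {k : ℕ}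
    (hp : p.degree < k) :
    polynomialLp ν p ∈
      Submodule.span ℝ ((fun i => polynomialLp ν (Polynomial.X ^ i)) '' Set.Iio k) := by
  have h : p ∈ Polynomial.degreeLT ℝ k := Polynomial.mem_degreeLT.2 hp
  rw [Polynomial.degreeLT_eq_span_X_pow] at h
  have h2 := Submodule.mem_map_of_mem (f := polynomialLp ν) h
  rw [Submodule.map_span] at h2
  refine Submodule.span_mono ?_ h2
  rintro _ ⟨q, hq, rfl⟩
  rw [SetLike.mem_coe, Finset.mem_image] at hq
  obtain ⟨i, hi, rfl⟩ := hq
  exact ⟨i, Finset.mem_range.1 hi, rfl⟩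

/-- Weierstrass approximation together with density of continuous functions in `L²`. -/
theorem dense_span_polynomialLp [IsFiniteMeasure ν] :
    Dense (Submodule.span ℝ (Set.range fun i => polynomialLp ν (Polynomial.X ^ i)) :
      Set (Lp ℝ 2 ν)) := by
  have h1 : (Subalgebra.toSubmodule (polynomialFunctions (Set.Icc x y))).topologicalClosure = ⊤ :=
    congrArg Subalgebra.toSubmodule (polynomialFunctions_closure_eq_top x y)
  have h2 := (ContinuousMap.toLp_denseRange ℝ ν ℝ
    (ENNReal.ofNat_ne_top (n := 2))).topologicalClosure_map_submodule h1
  rw [← Submodule.dense_iff_topologicalClosure_eq_top] at h2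
  refine h2.mono ?_
  rintro _ ⟨_, ⟨p, -, rfl⟩, rfl⟩
  have h3 : polynomialLp ν p ∈ _ :=
    polynomialLp_mem_span (lt_of_le_of_lt Polynomial.degree_le_natDegree
      (Nat.cast_lt.2 (Nat.lt_succ_self p.natDegree)))
  exact Submodule.span_mono (Set.image_subset_range _ _) h3

/-- A symmetric pair whose conditional moments are triangular polynomials. -/
theorem maxCorrLE_of_polynomial [IsProbabilityMeasure μ] [IsProbabilityMeasure ν]
    {a b : Ω → Set.Icc x y} (ha : MeasurePreserving a μ ν) (hb : MeasurePreserving b μ ν)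
    (hsymm : ∀ F G : Set.Icc x y → ℝ, ∫ ω, F (a ω) * G (b ω) ∂μ = ∫ ω, G (a ω) * F (b ω) ∂μ)
    {c : ℝ} (l : ℕ → ℝ) (hl : ∀ k, k ≠ 0 → |l k| ≤ c)
    (htri : ∀ k : ℕ, ∃ q : Polynomial ℝ, q.degree < k ∧ ∀ p : Polynomial ℝ,
      ∫ ω, p.eval (a ω).1 * (b ω).1 ^ k ∂μ = ∫ t, p.eval t.1 * (l k * t.1 ^ k + q.eval t.1) ∂ν) :
    MaxCorrLE μ ν ν a b c := by
  -- Composition with `a` and with `b` embeds `L²(ν)` isometrically, and correlations become cross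
  -- inner products. The vector `v 0` is the constant `1`, so orthogonality to it is mean zero.
  let A : Lp ℝ 2 ν →ₗᵢ[ℝ] Lp ℝ 2 μ := Lp.compMeasurePreservingₗᵢ ℝ a ha
  let A' : Lp ℝ 2 ν →ₗᵢ[ℝ] Lp ℝ 2 μ := Lp.compMeasurePreservingₗᵢ ℝ b hb
  have hA : ∀ {F G : Set.Icc x y → ℝ} (hF : MemLp F 2 ν) (hG : MemLp G 2 ν),
      inner ℝ (A hF.toLp) (A' hG.toLp) = ∫ ω, F (a ω) * G (b ω) ∂μ := by
    intro F G hF hG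
    exact (hF.comp_measurePreserving ha).inner_toLp (hG.comp_measurePreserving hb)
  have h0 : ∀ {F : Set.Icc x y → ℝ} (hF : MemLp F 2 ν),
      inner ℝ (polynomialLp ν (Polynomial.X ^ 0)) hF.toLp = ∫ t, F t ∂ν := by
    intro F hF
    rw [polynomialLp_eq_toLp, MemLp.inner_toLp]
    simp
  intro F G hF hG hF0 hG0
  have := abs_inner_le_of_triangular A A' (fun i => polynomialLp ν (Polynomial.X ^ i))
    dense_span_polynomialLp ?_ ?_ l hl ?_ (f := hF.toLp) (g := hG.toLp)
    ((h0 hF).trans hF0) ((h0 hG).trans hG0)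
  · rwa [hA, hF.norm_toLp_eq_sqrt, hG.norm_toLp_eq_sqrt, mul_assoc] at this
  · change ‖polynomialLp ν (Polynomial.X ^ 0)‖ = 1
    rw [polynomialLp_eq_toLp, MemLp.norm_toLp_eq_sqrt]
    simp
  · intro f g
    have hf := Lp.memLp f
    have hg := Lp.memLp g
    rw [← Lp.toLp_coeFn f hf, ← Lp.toLp_coeFn g hg, hA, hA]
    exact hsymm _ _
  · intro k
    obtain ⟨q, hq, h⟩ := htri k
    refine ⟨polynomialLp ν q, polynomialLp_mem_span hq, fun i => ?_⟩
    rw [← map_smul, ← map_add, polynomialLp_eq_toLp, polynomialLp_eq_toLp, polynomialLp_eq_toLp,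
      hA, MemLp.inner_toLp]
    simpa [mul_comm] using h (Polynomial.X ^ i)

end Polynomial

/-! ### Two coordinates of a uniform point have maximal correlation at most one half -/

namespace RoundSphere

variable {d : ℕ}

/-- A coordinate of a point of the sphere. -/
noncomputable def coord (i : Fin (d + 1)) (x : RoundSphere d) : Set.Icc (-1 : ℝ) 1 :=
  ⟨x.coords i, by
    rw [Set.mem_Icc, ← abs_le, ← norm_coords x]
    exact PiLp.norm_apply_le x.coords i⟩

theorem measurable_coord (i : Fin (d + 1)) : Measurable (coord (d := d) i) := by
  refine Measurable.subtype_mk ?_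
  exact (EuclideanSpace.proj i : EuclideanSpace ℝ (Fin (d + 1)) →L[ℝ] ℝ).continuous.measurable.comp
    measurable_coords

/-- Interchange of the first two coordinates. -/
noncomputable def swap (x : RoundSphere (d + 1)) : RoundSphere (d + 1) :=
  isometryMap (LinearIsometryEquiv.piLpCongrLeft 2 ℝ ℝ (Equiv.swap 0 1)) x

theorem coords_swap_apply (x : RoundSphere (d + 1)) (i : Fin (d + 2)) :
    (swap x).coords i = x.coords (Equiv.swap 0 1 i) := by
  simp [swap, isometryMap, LinearIsometryEquiv.piLpCongrLeft_apply, Equiv.piCongrLeft']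

theorem swap_swap (x : RoundSphere (d + 1)) : swap (swap x) = x := by
  apply coords_injective
  ext i
  rw [coords_swap_apply, coords_swap_apply, Equiv.swap_apply_self]

theorem measurePreserving_swap :
    MeasurePreserving (swap (d := d)) (uniformMeasure (d + 1)) (uniformMeasure (d + 1)) :=
  measurePreserving_isometryMap _

theorem integrable_coord_pow (i : Fin (d + 1)) (k : ℕ) :
    Integrable (fun x : RoundSphere d => (coord i x).1 ^ k) (uniformMeasure d) := by
  refine Integrable.of_bound (C := 1)
    ((measurable_subtype_coe.comp (measurable_coord i)).pow_const k).aestronglyMeasurable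
    (.of_forall fun x => ?_)
  rw [norm_pow]
  exact pow_le_one₀ (norm_nonneg _) (abs_le.2 (coord i x).2)

theorem integral_coord_pow_odd (i : Fin (d + 1)) {k : ℕ} (hk : Odd k) :
    ∫ x, (coord i x).1 ^ k ∂uniformMeasure d = 0 := by
  have h := measurePreserving_isometryMap (d := d) (LinearIsometryEquiv.neg ℝ)
  have h1 : ∫ x, (coord i x).1 ^ k ∂uniformMeasure d =
      ∫ x, (coord i (isometryMap (LinearIsometryEquiv.neg ℝ) x)).1 ^ k ∂uniformMeasure d := by
    conv_lhs => rw [← h.map_eq]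
    exact integral_map h.aemeasurable (by rw [h.map_eq]; exact (integrable_coord_pow i k).1)
  have h2 : ∀ x, (coord i (isometryMap (LinearIsometryEquiv.neg ℝ) x)).1 ^ k =
      -((coord i x).1 ^ k) := fun x => by
    rw [← hk.neg_pow]; rfl
  simp_rw [h2, integral_neg] at h1
  linarith

/-- Two coordinates are available, with equal second moments by symmetry, and their squares sum to
at most one. -/
theorem integral_coord_sq_le : ∫ x, (coord 0 x).1 ^ 2 ∂uniformMeasure (d + 1) ≤ 1 / 2 := by
  have h := measurePreserving_swap (d := d)
  have h1 : ∫ x, (coord 0 x).1 ^ 2 ∂uniformMeasure (d + 1) =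
      ∫ x, (coord 1 x).1 ^ 2 ∂uniformMeasure (d + 1) := by
    conv_lhs => rw [← h.map_eq]
    rw [integral_map h.aemeasurable (by rw [h.map_eq]; exact (integrable_coord_pow 0 2).1)]
    refine integral_congr_ae (.of_forall fun x => ?_)
    simp [coord, coords_swap_apply]
  have h2 : ∫ x, ((coord 0 x).1 ^ 2 + (coord 1 x).1 ^ 2) ∂uniformMeasure (d + 1) ≤
      ∫ x, (1 : ℝ) ∂uniformMeasure (d + 1) := by
    refine integral_mono ((integrable_coord_pow 0 2).add (integrable_coord_pow 1 2))
      (integrable_const _) fun x => ?_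
    have h3 : ‖x.coords‖ ^ 2 = ∑ i, x.coords i ^ 2 := EuclideanSpace.real_norm_sq_eq _
    rw [norm_coords, one_pow, Fin.sum_univ_succ, Fin.sum_univ_succ] at h3
    have h4 : 0 ≤ ∑ i : Fin d, x.coords i.succ.succ ^ 2 :=
      Finset.sum_nonneg fun i _ => sq_nonneg _
    change x.coords 0 ^ 2 + x.coords 1 ^ 2 ≤ 1
    rw [h3, ← add_assoc]
    exact le_add_of_nonneg_right h4
  rw [integral_add (integrable_coord_pow 0 2) (integrable_coord_pow 1 2), ← h1] at h2
  simp at h2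
  linarith

/-- Odd moments vanish under the antipodal map; positive even ones are at most the second moment
because coordinates lie in `[-1, 1]`. -/
theorem abs_integral_coord_pow_le {k : ℕ} (hk : k ≠ 0) :
    |∫ x, (coord 0 x).1 ^ k ∂uniformMeasure (d + 1)| ≤ 1 / 2 := by
  rcases Nat.even_or_odd k with h | h
  · have h2 : 2 ≤ k := by obtain ⟨j, rfl⟩ := h; omega
    rw [abs_of_nonneg (integral_nonneg fun x => h.pow_nonneg _)]
    refine (integral_mono (integrable_coord_pow 0 k) (integrable_coord_pow 0 2) fun x => ?_).trans
      integral_coord_sq_le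
    simp only
    rw [← h.pow_abs, ← even_two.pow_abs]
    exact pow_le_pow_of_le_one (abs_nonneg _) (abs_le.2 (coord 0 x).2) h2
  · rw [integral_coord_pow_odd 0 h, abs_zero]; norm_num

theorem coord_zero_join (p : Set.Icc (-1 : ℝ) 1 × RoundSphere d) : coord 0 (join p) = p.1 :=
  Subtype.ext rfl

theorem coord_swap_join (p : Set.Icc (-1 : ℝ) 1 × RoundSphere d) :
    (coord 0 (swap (join p))).1 = √(1 - p.1.1 ^ 2) * (coord 0 p.2).1 := by
  change (swap (join p)).coords 0 = _
  rw [coords_swap_apply, Equiv.swap_apply_left]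
  rfl

theorem measurePreserving_coord_zero {ν : Measure (Set.Icc (-1 : ℝ) 1)}
    (hν : MeasurePreserving join (ν.prod (uniformMeasure d)) (uniformMeasure (d + 1))) :
    MeasurePreserving (coord 0) (uniformMeasure (d + 1)) ν := by
  refine ⟨measurable_coord 0, ?_⟩
  rw [← hν.map_eq, Measure.map_map (measurable_coord 0) hν.measurable]
  have : coord 0 ∘ join = (Prod.fst : Set.Icc (-1 : ℝ) 1 × RoundSphere d → _) :=
    funext coord_zero_join
  rw [this]
  change (ν.prod (uniformMeasure d)).fst = ν
  exact Measure.fst_prod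

open Polynomial in
theorem exists_degree_lt_one_sub_sq_pow (j : ℕ) : ∃ q : ℝ[X], q.degree < ((2 * j : ℕ) : WithBot ℕ) ∧
    (1 - X ^ 2) ^ j = C ((-1) ^ j) * X ^ (2 * j) + q := by
  have h1 : (X ^ 2 - C 1 : ℝ[X]).Monic := monic_X_pow_sub_C 1 two_ne_zero
  have h2 : ((X ^ 2 - C 1 : ℝ[X]) ^ j).degree = ((2 * j : ℕ) : WithBot ℕ) := by
    rw [degree_pow, degree_X_pow_sub_C two_pos]
    simp [mul_comm]
  have h3 : ((X ^ 2 - C 1 : ℝ[X]) ^ j - X ^ (2 * j)).degree <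
      ((2 * j : ℕ) : WithBot ℕ) := by
    rw [← h2]
    exact degree_sub_lt_left (by rw [h2, degree_X_pow]) (h1.pow j).ne_zero
      (by rw [(h1.pow j).leadingCoeff, leadingCoeff_X_pow])
  refine ⟨C ((-1) ^ j) * ((X ^ 2 - C 1) ^ j - X ^ (2 * j)), ?_, ?_⟩
  · rwa [degree_C_mul (by simp)]
  · have : (1 - X ^ 2 : ℝ[X]) = C (-1) * (X ^ 2 - C 1) := by simp
    rw [this, mul_pow, C_pow]
    ring

/-- Over height `t` the other coordinate is `√(1 - t²)` times a coordinate of an independent uniform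
point of the equator. Its conditional moments are therefore polynomials in `t` with explicit leading
coefficients. -/
theorem maxCorrLE_coord {ν : Measure (Set.Icc (-1 : ℝ) 1)} [IsProbabilityMeasure ν]
    (hν : MeasurePreserving join (ν.prod (uniformMeasure (d + 1))) (uniformMeasure (d + 2))) :
    MaxCorrLE (uniformMeasure (d + 2)) ν ν (coord 0) (fun x => coord 0 (swap x)) (1 / 2) := by
  have hc := measurePreserving_coord_zero hν
  have hs := measurePreserving_swap (d := d + 1)
  let e : RoundSphere (d + 2) ≃ᵐ RoundSphere (d + 2) :=
    ⟨⟨swap, swap, swap_swap, swap_swap⟩, hs.measurable, hs.measurable⟩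
  let M : ℕ → ℝ := fun k => ∫ x, (coord 0 x).1 ^ k ∂uniformMeasure (d + 1)
  have hM : ∀ k, k ≠ 0 → |M k| ≤ 1 / 2 := fun k hk => abs_integral_coord_pow_le hk
  -- The sign is the leading coefficient of `(1 - t²)^(k/2)` for even `k`; for odd `k` the moment `M
  -- k` is zero and the rounding in `k / 2` is harmless.
  refine maxCorrLE_of_polynomial hc (hc.comp hs) (fun F G => ?_)
    (fun k => (-1) ^ (k / 2) * M k) (fun k hk => ?_) (fun k => ?_)
  · have := MeasurePreserving.integral_comp' (f := e) hs
      fun x => F (coord 0 x) * G (coord 0 (swap x))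
    simp only [Function.comp_apply]
    rw [← this]
    refine integral_congr_ae (.of_forall fun x => ?_)
    change F (coord 0 (swap x)) * G (coord 0 (swap (swap x))) = _
    rw [swap_swap, mul_comm]
  · rw [abs_mul, abs_pow, abs_neg, abs_one, one_pow, one_mul]
    exact hM k hk
  · have hint : ∀ p : Polynomial ℝ,
        ∫ ω, p.eval (coord 0 ω).1 * (coord 0 (swap ω)).1 ^ k ∂uniformMeasure (d + 2) =
          (∫ t, p.eval t.1 * √(1 - t.1 ^ 2) ^ k ∂ν) * M k := by
      intro p
      have hm : Measurable fun ω : RoundSphere (d + 2) =>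
          p.eval (coord 0 ω).1 * (coord 0 (swap ω)).1 ^ k :=
        (p.continuous.measurable.comp (measurable_subtype_coe.comp (measurable_coord 0))).mul
          ((measurable_subtype_coe.comp ((measurable_coord 0).comp hs.measurable)).pow_const k)
      rw [← hν.map_eq, integral_map hν.aemeasurable hm.aestronglyMeasurable, ← integral_prod_mul]
      refine integral_congr_ae (.of_forall fun z => ?_)
      simp only [coord_zero_join, coord_swap_join]
      ring
    rcases Nat.even_or_odd' k with ⟨j, rfl | rfl⟩
    · obtain ⟨q, hq, h⟩ := exists_degree_lt_one_sub_sq_pow j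
      refine ⟨Polynomial.C (M (2 * j)) * q, ?_, fun p => ?_⟩
      · exact lt_of_le_of_lt (Polynomial.smul_eq_C_mul (M (2 * j)) ▸ Polynomial.degree_smul_le _ _) hq
      · refine (hint p).trans ?_
        rw [← integral_mul_const]
        refine integral_congr_ae (.of_forall fun t => ?_)
        have ht : 0 ≤ 1 - t.1 ^ 2 := by nlinarith [t.2.1, t.2.2]
        have h2 := congrArg (Polynomial.eval t.1) h
        simp only [Polynomial.eval_pow, Polynomial.eval_sub, Polynomial.eval_one,
          Polynomial.eval_X, Polynomial.eval_add, Polynomial.eval_mul, Polynomial.eval_C] at h2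
        have h3 : 2 * j / 2 = j := by omega
        simp only [pow_mul √_, Real.sq_sqrt ht, h2, h3, Polynomial.eval_mul, Polynomial.eval_C]
        ring
    · have h0 : M (2 * j + 1) = 0 := integral_coord_pow_odd 0 ⟨j, rfl⟩
      refine ⟨0, by rw [Polynomial.degree_zero]; exact WithBot.bot_lt_coe _, fun p => ?_⟩
      refine (hint p).trans ?_
      simp [h0]

end RoundSphere

/-! ### Suspension of maps and its Lipschitz constant -/

namespace RoundSphere

variable {d : ℕ}

theorem norm_coords_sub_le_dist (x y : RoundSphere d) : ‖x.coords - y.coords‖ ≤ dist x y := by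
  refine le_of_sq_le_sq ?_ dist_nonneg
  have := Real.one_sub_sq_div_two_le_cos (x := dist x y)
  rw [norm_coords_sub_sq]
  linarith

theorem dist_le_norm_coords_sub (x y : RoundSphere d) :
    dist x y ≤ Real.pi / 2 * ‖x.coords - y.coords‖ := by
  have h0 : (0 : ℝ) ≤ dist x y := dist_nonneg
  have h1 : |dist x y| ≤ Real.pi := by
    rw [abs_of_nonneg h0]
    exact InnerProductGeometry.angle_le_pi _ _
  have h2 := Real.cos_le_one_sub_mul_cos_sq h1
  refine le_of_sq_le_sq ?_ (by positivity)
  rw [mul_pow, norm_coords_sub_sq]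
  have hpi : (0 : ℝ) < Real.pi ^ 2 := by positivity
  have h3 : (Real.pi / 2) ^ 2 * (2 - 2 * (1 - 2 / Real.pi ^ 2 * dist x y ^ 2))
      = dist x y ^ 2 := by
    field_simp
    ring
  rw [← h3]
  gcongr

/-- The equatorial point below a point of `S^(d+1)`; the value at the poles is immaterial. -/
noncomputable def equator (x : RoundSphere (d + 1)) : RoundSphere d :=
  normalize (WithLp.toLp 2 fun i : Fin (d + 1) => x.coords i.succ)

theorem measurable_equator : Measurable (equator (d := d)) := by
  refine measurable_normalize.comp ?_
  have : Continuous fun v : EuclideanSpace ℝ (Fin (d + 2)) =>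
      (WithLp.toLp 2 fun i : Fin (d + 1) => v i.succ : EuclideanSpace ℝ (Fin (d + 1))) := by
    fun_prop
  exact this.measurable.comp measurable_coords

theorem join_coord_equator (x : RoundSphere (d + 1)) : join (coord 0 x, equator x) = x := by
  set v : EuclideanSpace ℝ (Fin (d + 1)) := WithLp.toLp 2 fun i : Fin (d + 1) => x.coords i.succ
    with hv
  have h1 : x.coords = consVec (x.coords 0, v) := by
    ext i
    refine Fin.cases ?_ (fun j => ?_) i <;> simp [consVec, hv]
  have h2 : x.coords 0 ^ 2 + ‖v‖ ^ 2 = 1 := by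
    rw [← norm_consVec_sq (x.coords 0, v), ← h1, norm_coords, one_pow]
  have h3 : √(1 - x.coords 0 ^ 2) = ‖v‖ := by
    rw [← h2, add_sub_cancel_left, Real.sqrt_sq (norm_nonneg _)]
  apply coords_injective
  rw [h1]
  change consVec (x.coords 0, √(1 - x.coords 0 ^ 2) • (normalize v).coords) = _
  congr 2
  rw [h3]
  by_cases h0 : v = 0
  · simp [h0]
  · rw [coords_normalize h0, smul_smul, mul_inv_cancel₀ (norm_ne_zero_iff.2 h0), one_smul]

/-- The suspension of a self-map of `S^d`. -/
noncomputable def suspend (φ : RoundSphere d → RoundSphere d) (x : RoundSphere (d + 1)) :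
    RoundSphere (d + 1) :=
  join (coord 0 x, φ (equator x))

/-- At the poles `equator` does not recover `y`, but there the radius `√(1 - t²)` vanishes and
`join` ignores the equatorial point. -/
theorem suspend_join (φ : RoundSphere d → RoundSphere d) (t : Set.Icc (-1 : ℝ) 1)
    (y : RoundSphere d) : suspend φ (join (t, y)) = join (t, φ y) := by
  have h1 : equator (join (t, y)) = normalize (√(1 - t.1 ^ 2) • y.coords) := rfl
  rw [suspend, coord_zero_join, h1]
  rcases (Real.sqrt_nonneg (1 - t.1 ^ 2)).eq_or_lt with h | h
  · apply coords_injective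
    simp [join, ← h]
  · rw [normalize_smul_coords h]

theorem suspend_comp (φ ψ : RoundSphere d → RoundSphere d) (x : RoundSphere (d + 1)) :
    suspend φ (suspend ψ x) = suspend (φ ∘ ψ) x := by
  conv_lhs => rw [← join_coord_equator x]
  rw [suspend_join, suspend_join]
  rfl

theorem suspend_id (x : RoundSphere (d + 1)) : suspend id x = x := join_coord_equator x

theorem measurePreserving_suspend {φ : RoundSphere d → RoundSphere d}
    (hφ : MeasurePreserving φ (uniformMeasure d) (uniformMeasure d)) :
    MeasurePreserving (suspend φ) (uniformMeasure (d + 1)) (uniformMeasure (d + 1)) := by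
  obtain ⟨ν, _, hν⟩ := exists_measurePreserving_join d
  have hm : Measurable (suspend φ) := measurable_join.comp
    ((measurable_coord 0).prodMk (hφ.measurable.comp measurable_equator))
  refine ⟨hm, ?_⟩
  have h1 : suspend φ ∘ join = join ∘ Prod.map id φ := funext fun p => suspend_join φ p.1 p.2
  have h2 := hν.comp ((MeasurePreserving.id ν).prod hφ)
  conv_lhs => rw [← hν.map_eq]
  rw [Measure.map_map hm measurable_join, h1, h2.map_eq]

/-- In this splitting of the squared chord a suspension alters only the last term, so chordal
Lipschitz constants at least one are inherited from the equator. -/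
theorem norm_join_sub_sq (p q : Set.Icc (-1 : ℝ) 1 × RoundSphere d) :
    ‖(join p).coords - (join q).coords‖ ^ 2 = (p.1.1 - q.1.1) ^ 2 +
      ((√(1 - p.1.1 ^ 2) - √(1 - q.1.1 ^ 2)) ^ 2 +
        √(1 - p.1.1 ^ 2) * √(1 - q.1.1 ^ 2) * ‖p.2.coords - q.2.coords‖ ^ 2) := by
  simp only [join, coords_ofCoords]
  rw [consVec_sub, norm_consVec_sq]
  congr 1
  simp only [Prod.snd_sub]
  rw [@norm_sub_sq_real, @norm_sub_sq_real, norm_smul, norm_smul, norm_coords, norm_coords,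
    inner_smul_left, inner_smul_right, Real.norm_of_nonneg (Real.sqrt_nonneg _),
    Real.norm_of_nonneg (Real.sqrt_nonneg _)]
  simp
  ring

/-- The Lipschitz constant of suspensions. -/
noncomputable def suspensionConstant (K : ℝ≥0) : ℝ≥0 :=
  (Real.pi / 2).toNNReal * (1 + K * (Real.pi / 2).toNNReal)

theorem lipschitzWith_suspend {φ : RoundSphere d → RoundSphere d} {K : ℝ≥0}
    (hφ : LipschitzWith K φ) : LipschitzWith (suspensionConstant K) (suspend φ) := by
  refine LipschitzWith.of_dist_le_mul fun x x' => ?_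
  have hpi : ((Real.pi / 2).toNNReal : ℝ) = Real.pi / 2 := Real.coe_toNNReal _ (by positivity)
  -- Passing from chord to angle costs `π / 2`, so `K * (π / 2)` is a chordal Lipschitz constant of
  -- `φ`. The added `1` covers the height and radius terms.
  set L : ℝ := 1 + K * (Real.pi / 2) with hL
  have hL1 : 1 ≤ L := le_add_of_nonneg_right (by positivity)
  have hchord : ∀ y y' : RoundSphere d,
      ‖(φ y).coords - (φ y').coords‖ ≤ L * ‖y.coords - y'.coords‖ := fun y y' => by
    calc _ ≤ dist (φ y) (φ y') := norm_coords_sub_le_dist _ _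
      _ ≤ K * dist y y' := hφ.dist_le_mul _ _
      _ ≤ K * (Real.pi / 2 * ‖y.coords - y'.coords‖) := by
          gcongr; exact dist_le_norm_coords_sub _ _
      _ = (K * (Real.pi / 2)) * ‖y.coords - y'.coords‖ := by ring
      _ ≤ _ := by gcongr; exact le_add_of_nonneg_left zero_le_one
  have hmain : ‖(suspend φ x).coords - (suspend φ x').coords‖ ≤ L * ‖x.coords - x'.coords‖ := by
    refine le_of_sq_le_sq ?_ (by positivity)
    rw [mul_pow]
    conv_rhs => rw [← join_coord_equator x, ← join_coord_equator x']
    rw [suspend, suspend, norm_join_sub_sq, norm_join_sub_sq, mul_add, mul_add]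
    have h1 : 1 ≤ L ^ 2 := one_le_pow₀ hL1
    refine add_le_add (le_mul_of_one_le_left (sq_nonneg _) h1)
      (add_le_add (le_mul_of_one_le_left (sq_nonneg _) h1) ?_)
    rw [mul_left_comm, ← mul_pow]
    gcongr
    exact hchord _ _
  calc _ ≤ Real.pi / 2 * ‖(suspend φ x).coords - (suspend φ x').coords‖ :=
        dist_le_norm_coords_sub _ _
    _ ≤ Real.pi / 2 * (L * dist x x') := by
        gcongr
        exact hmain.trans (by gcongr; exact norm_coords_sub_le_dist _ _)
    _ = _ := by
        rw [suspensionConstant]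
        push_cast
        rw [hpi, hL]
        ring

theorem dist_swap (x y : RoundSphere (d + 1)) : dist (swap x) (swap y) = dist x y := by
  rw [dist_eq_arccos, dist_eq_arccos]
  congr 1
  exact LinearIsometryEquiv.inner_map_map _ _ _

/-- The suspension of a measure-preserving bijection. -/
noncomputable def suspension (φ : MeasurePreservingBijection (uniformMeasure d)) :
    MeasurePreservingBijection (uniformMeasure (d + 1)) :=
  ⟨⟨suspend φ.1, suspend φ.1.symm,
    fun x => by rw [suspend_comp, Equiv.symm_comp_self, suspend_id],
    fun x => by rw [suspend_comp, Equiv.self_comp_symm, suspend_id]⟩,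
    measurePreserving_suspend φ.2⟩

/-- Conjugation of a measure-preserving bijection by the interchange of two coordinates. -/
noncomputable def swapConj (φ : MeasurePreservingBijection (uniformMeasure (d + 1))) :
    MeasurePreservingBijection (uniformMeasure (d + 1)) :=
  ⟨⟨fun x => swap (φ.1 (swap x)), fun x => swap (φ.1.symm (swap x)),
    fun x => by simp [swap_swap], fun x => by simp [swap_swap]⟩,
    measurePreserving_swap.comp (φ.2.comp measurePreserving_swap)⟩

theorem lipschitzWith_suspension {φ : MeasurePreservingBijection (uniformMeasure d)} {K : ℝ≥0}
    (h : LipschitzWith K φ.1 ∧ LipschitzWith K φ.1.symm) :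
    LipschitzWith (suspensionConstant K) (suspension φ).1 ∧
      LipschitzWith (suspensionConstant K) (suspension φ).1.symm :=
  ⟨lipschitzWith_suspend h.1, lipschitzWith_suspend h.2⟩

theorem lipschitzWith_swapConj {φ : MeasurePreservingBijection (uniformMeasure (d + 1))}
    {K : ℝ≥0} (h : LipschitzWith K φ.1 ∧ LipschitzWith K φ.1.symm) :
    LipschitzWith K (swapConj φ).1 ∧ LipschitzWith K (swapConj φ).1.symm := by
  constructor
  · refine LipschitzWith.of_dist_le_mul fun x y => ?_
    rw [← dist_swap x y]
    exact (dist_swap _ _).trans_le (h.1.dist_le_mul _ _)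
  · refine LipschitzWith.of_dist_le_mul fun x y => ?_
    rw [← dist_swap x y]
    exact (dist_swap _ _).trans_le (h.2.dist_le_mul _ _)

end RoundSphere

/-! ### Averaging operators on real-valued functions -/

section Averaging

variable {M : Type*} [MeasurableSpace M] {μ : Measure M}

/-- The averaging operator on real-valued functions. -/
noncomputable def realAverage (P : MeasurePreservingBijection μ →₀ ℝ) {n : ℕ}
    (f : (Fin n → M) → ℝ) (x : Fin n → M) : ℝ :=
  P.sum fun φ w => w * f (fun i => φ.1 (x i))

theorem averagingOperator_ofReal (P : MeasurePreservingBijection μ →₀ ℝ) {n : ℕ}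
    (f : (Fin n → M) → ℝ) (x : Fin n → M) :
    averagingOperator P (fun x => (f x : ℂ)) x = (realAverage P f x : ℂ) := by
  simp [averagingOperator, realAverage, Finsupp.sum]

theorem re_averagingOperator (P : MeasurePreservingBijection μ →₀ ℝ) {n : ℕ}
    (f : (Fin n → M) → ℂ) (x : Fin n → M) :
    (averagingOperator P f x).re = realAverage P (fun x => (f x).re) x := by
  simp [averagingOperator, realAverage, Finsupp.sum]

theorem im_averagingOperator (P : MeasurePreservingBijection μ →₀ ℝ) {n : ℕ}
    (f : (Fin n → M) → ℂ) (x : Fin n → M) :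
    (averagingOperator P f x).im = realAverage P (fun x => (f x).im) x := by
  simp [averagingOperator, realAverage, Finsupp.sum]

variable [SigmaFinite μ]

theorem MeasurePreservingBijection.pi (φ : MeasurePreservingBijection μ) (n : ℕ) :
    MeasurePreserving (fun (x : Fin n → M) i => φ.1 (x i)) (Measure.pi fun _ => μ)
      (Measure.pi fun _ => μ) :=
  measurePreserving_pi _ _ fun _ => φ.2

theorem MeasureTheory.MemLp.realAverage (P : MeasurePreservingBijection μ →₀ ℝ) {n : ℕ}
    {f : (Fin n → M) → ℝ} (hf : MemLp f 2 (Measure.pi fun _ => μ)) :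
    MemLp (realAverage P f) 2 (Measure.pi fun _ => μ) :=
  memLp_finsetSum P.support fun φ _ =>
    (hf.comp_measurePreserving (φ.pi n)).const_mul (P φ)

theorem MeasureTheory.MemLp.averagingOperator (P : MeasurePreservingBijection μ →₀ ℝ) {n : ℕ}
    {f : (Fin n → M) → ℂ} (hf : MemLp f 2 (Measure.pi fun _ => μ)) :
    MemLp (averagingOperator P f) 2 (Measure.pi fun _ => μ) :=
  memLp_finsetSum P.support fun φ _ =>
    (hf.comp_measurePreserving (φ.pi n)).const_mul (P φ : ℂ)

theorem MeasureTheory.MeasurePreserving.integral_comp_of_aestronglyMeasurable {A B : Type*}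
    [MeasurableSpace A] [MeasurableSpace B] {α : Measure A} {β : Measure B} {g : A → B}
    (hg : MeasurePreserving g α β) {f : B → ℝ} (hf : AEStronglyMeasurable f β) :
    ∫ x, f (g x) ∂α = ∫ y, f y ∂β := by
  rw [← hg.map_eq, integral_map hg.aemeasurable (by rwa [hg.map_eq])]

theorem integral_realAverage {P : MeasurePreservingBijection μ →₀ ℝ}
    (hP : IsProbabilityWeight P) {n : ℕ} {f : (Fin n → M) → ℝ}
    (hf : Integrable f (Measure.pi fun _ => μ)) :
    ∫ x, realAverage P f x ∂(Measure.pi fun _ => μ) = ∫ x, f x ∂(Measure.pi fun _ => μ) := by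
  unfold realAverage Finsupp.sum
  rw [integral_finsetSum _ fun φ _ =>
    ((φ.pi n).integrable_comp_of_integrable hf).const_mul (P φ)]
  have : ∀ φ : MeasurePreservingBijection μ,
      ∫ x, P φ * f (fun i => φ.1 (x i)) ∂(Measure.pi fun _ => μ) =
        P φ * ∫ x, f x ∂(Measure.pi fun _ => μ) := fun φ => by
    rw [integral_const_mul, (φ.pi n).integral_comp_of_aestronglyMeasurable hf.1]
  simp_rw [this]
  rw [← Finset.sum_mul]
  exact (congrArg (· * _) hP.2).trans (one_mul _)

end Averaging

/-! ### Passage between complex norm bounds and real square integrals -/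

section NormBounds

variable {A : Type*} [MeasurableSpace A] {α : Measure A}

theorem MeasureTheory.MemLp.eLpNorm_eq_sqrt {f : A → ℝ} (hf : MemLp f 2 α) :
    eLpNorm f 2 α = ENNReal.ofReal √(∫ x, f x ^ 2 ∂α) := by
  rw [← hf.norm_toLp_eq_sqrt, Lp.norm_toLp, ENNReal.ofReal_toReal hf.eLpNorm_ne_top]

theorem MeasureTheory.MemLp.eLpNorm_complex_eq_sqrt {f : A → ℂ} (hf : MemLp f 2 α) :
    eLpNorm f 2 α = ENNReal.ofReal √(∫ x, (f x).re ^ 2 ∂α + ∫ x, (f x).im ^ 2 ∂α) := by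
  have hre : MemLp (fun x => (f x).re) 2 α := hf.re
  have him : MemLp (fun x => (f x).im) 2 α := hf.im
  rw [← eLpNorm_norm, hf.norm.eLpNorm_eq_sqrt, ← integral_add hre.integrable_sq him.integrable_sq]
  simp_rw [Complex.sq_norm, Complex.normSq_apply, sq]

variable {M : Type*} [MeasurableSpace M] {μ : Measure M} [IsProbabilityMeasure μ]

theorem integral_realAverage_sq_le_of_eLpNorm_le {P : MeasurePreservingBijection μ →₀ ℝ} {n : ℕ}
    {c : ℝ} (hc : 0 ≤ c)
    (h : ∀ f : (Fin n → M) → ℂ, MemLp f 2 (Measure.pi fun _ => μ) →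
      ∫ x, f x ∂(Measure.pi fun _ => μ) = 0 →
      eLpNorm (averagingOperator P f) 2 (Measure.pi fun _ => μ) ≤
        ENNReal.ofReal c * eLpNorm f 2 (Measure.pi fun _ => μ))
    {f : (Fin n → M) → ℝ} (hf : MemLp f 2 (Measure.pi fun _ => μ))
    (hf0 : ∫ x, f x ∂(Measure.pi fun _ => μ) = 0) :
    ∫ x, realAverage P f x ^ 2 ∂(Measure.pi fun _ => μ) ≤
      c ^ 2 * ∫ x, f x ^ 2 ∂(Measure.pi fun _ => μ) := by
  have h1 := h (fun x => (f x : ℂ)) hf.ofReal (by rw [integral_complex_ofReal, hf0]; simp)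
  have h2 : ∀ {g : (Fin n → M) → ℝ}, MemLp g 2 (Measure.pi fun _ => μ) →
      eLpNorm (fun x => (g x : ℂ)) 2 (Measure.pi fun _ => μ) =
        ENNReal.ofReal √(∫ x, g x ^ 2 ∂(Measure.pi fun _ => μ)) := fun {g} hg => by
    rw [← hg.eLpNorm_eq_sqrt]
    exact eLpNorm_congr_norm_ae (.of_forall fun x => by simp)
  have h3 : averagingOperator P (fun x => (f x : ℂ)) = fun x => (realAverage P f x : ℂ) :=
    funext fun x => averagingOperator_ofReal P f x
  rw [h3, h2 (hf.realAverage P), h2 hf, ← ENNReal.ofReal_mul hc,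
    ENNReal.ofReal_le_ofReal_iff (by positivity)] at h1
  have h4 := pow_le_pow_left₀ (Real.sqrt_nonneg _) h1 2
  rwa [mul_pow, Real.sq_sqrt (integral_nonneg fun _ => sq_nonneg _),
    Real.sq_sqrt (integral_nonneg fun _ => sq_nonneg _)] at h4

/-- The weights are real, so averaging commutes with real and imaginary parts, whose squared norms
add. -/
theorem eLpNorm_averagingOperator_le {P : MeasurePreservingBijection μ →₀ ℝ} {n : ℕ}
    {c : ℝ} (hc : 0 ≤ c)
    (h : ∀ f : (Fin n → M) → ℝ, MemLp f 2 (Measure.pi fun _ => μ) →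
      ∫ x, f x ∂(Measure.pi fun _ => μ) = 0 →
      ∫ x, realAverage P f x ^ 2 ∂(Measure.pi fun _ => μ) ≤
        c ^ 2 * ∫ x, f x ^ 2 ∂(Measure.pi fun _ => μ))
    {f : (Fin n → M) → ℂ} (hf : MemLp f 2 (Measure.pi fun _ => μ))
    (hf0 : ∫ x, f x ∂(Measure.pi fun _ => μ) = 0) :
    eLpNorm (averagingOperator P f) 2 (Measure.pi fun _ => μ) ≤
      ENNReal.ofReal c * eLpNorm f 2 (Measure.pi fun _ => μ) := by
  have hi : Integrable f (Measure.pi fun _ => μ) := hf.integrable (by norm_num)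
  have h1 := h _ hf.re (by
    have := integral_re hi
    simpa [hf0] using this)
  have h2 := h _ hf.im (by
    have := integral_im hi
    simpa [hf0] using this)
  rw [(hf.averagingOperator P).eLpNorm_complex_eq_sqrt, hf.eLpNorm_complex_eq_sqrt,
    ← ENNReal.ofReal_mul hc]
  refine ENNReal.ofReal_le_ofReal ?_
  rw [← Real.sqrt_sq hc, ← Real.sqrt_mul (sq_nonneg c), mul_add]
  simp_rw [re_averagingOperator, im_averagingOperator]
  exact Real.sqrt_le_sqrt (add_le_add h1 h2)

/-- Averaging fixes the mean and contracts the variance. Fibre restrictions have nonzero mean, so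
this is the version applied on fibres. -/
theorem integral_realAverage_sq_le {P : MeasurePreservingBijection μ →₀ ℝ}
    (hP : IsProbabilityWeight P) {n : ℕ} {c : ℝ}
    (h : ∀ f : (Fin n → M) → ℝ, MemLp f 2 (Measure.pi fun _ => μ) →
      ∫ x, f x ∂(Measure.pi fun _ => μ) = 0 →
      ∫ x, realAverage P f x ^ 2 ∂(Measure.pi fun _ => μ) ≤
        c ^ 2 * ∫ x, f x ^ 2 ∂(Measure.pi fun _ => μ))
    {f : (Fin n → M) → ℝ} (hf : MemLp f 2 (Measure.pi fun _ => μ)) :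
    ∫ x, realAverage P f x ^ 2 ∂(Measure.pi fun _ => μ) ≤
      c ^ 2 * ∫ x, f x ^ 2 ∂(Measure.pi fun _ => μ) +
        (1 - c ^ 2) * (∫ x, f x ∂(Measure.pi fun _ => μ)) ^ 2 := by
  have hi : Integrable f (Measure.pi fun _ => μ) := hf.integrable (by norm_num)
  set m := ∫ x, f x ∂(Measure.pi fun _ => μ) with hm
  have h1 := h (fun x => f x - m) (hf.sub (memLp_const m))
    (by rw [integral_sub hi (integrable_const _)]; simp [hm])
  have h2 : ∀ x, realAverage P (fun x => f x - m) x = realAverage P f x -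
      ∫ x, realAverage P f x ∂(Measure.pi fun _ => μ) := fun x => by
    have hw : ∑ φ ∈ P.support, P φ * m = m := by
      rw [← Finset.sum_mul]
      exact (congrArg (· * _) hP.2).trans (one_mul _)
    rw [integral_realAverage hP hi, ← hm, realAverage, realAverage, Finsupp.sum, Finsupp.sum]
    simp_rw [mul_sub]
    rw [Finset.sum_sub_distrib, hw]
  simp_rw [h2] at h1
  rw [integral_sub_integral_sq (hf.realAverage P), integral_sub_integral_sq hf,
    integral_realAverage hP hi] at h1
  linarith

end NormBounds

/-! ### Contraction on latitudes and the expansion of the mixture -/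

namespace RoundSphere

variable {d n : ℕ}

/-- The points of `S^(d+1)` over several equatorial points at the given heights. -/
noncomputable def joins (p : (Fin n → Set.Icc (-1 : ℝ) 1) × (Fin n → RoundSphere d))
    (i : Fin n) : RoundSphere (d + 1) :=
  join (p.1 i, p.2 i)

theorem measurePreserving_joins {ν : Measure (Set.Icc (-1 : ℝ) 1)} [IsProbabilityMeasure ν]
    (hν : MeasurePreserving join (ν.prod (uniformMeasure d)) (uniformMeasure (d + 1))) :
    MeasurePreserving (joins (n := n))
      ((Measure.pi fun _ => ν).prod (Measure.pi fun _ => uniformMeasure d))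
      (Measure.pi fun _ => uniformMeasure (d + 1)) := by
  have h1 := (measurePreserving_arrowProdEquivProdArrow (Set.Icc (-1 : ℝ) 1) (RoundSphere d)
    (Fin n) (fun _ => ν) (fun _ => uniformMeasure d)).symm
  exact (measurePreserving_pi _ _ fun _ => hν).comp h1

/-- The average of a function over all the latitudes at given heights. -/
noncomputable def latitudeAverage (f : (Fin n → RoundSphere (d + 1)) → ℝ)
    (t : Fin n → Set.Icc (-1 : ℝ) 1) : ℝ :=
  ∫ y, f (joins (t, y)) ∂(Measure.pi fun _ => uniformMeasure d)

theorem memLp_latitudeAverage {ν : Measure (Set.Icc (-1 : ℝ) 1)} [IsProbabilityMeasure ν]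
    (hν : MeasurePreserving join (ν.prod (uniformMeasure d)) (uniformMeasure (d + 1)))
    {f : (Fin n → RoundSphere (d + 1)) → ℝ}
    (hf : MemLp f 2 (Measure.pi fun _ => uniformMeasure (d + 1))) :
    MemLp (latitudeAverage f) 2 (Measure.pi fun _ => ν) :=
  (hf.comp_measurePreserving (measurePreserving_joins hν)).integral_fibre

theorem integral_latitudeAverage {ν : Measure (Set.Icc (-1 : ℝ) 1)} [IsProbabilityMeasure ν]
    (hν : MeasurePreserving join (ν.prod (uniformMeasure d)) (uniformMeasure (d + 1)))
    {f : (Fin n → RoundSphere (d + 1)) → ℝ}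
    (hf : MemLp f 2 (Measure.pi fun _ => uniformMeasure (d + 1))) :
    ∫ t, latitudeAverage f t ∂(Measure.pi fun _ => ν) =
      ∫ x, f x ∂(Measure.pi fun _ => uniformMeasure (d + 1)) := by
  have hF := hf.comp_measurePreserving (measurePreserving_joins hν)
  rw [← (measurePreserving_joins hν).integral_comp_of_aestronglyMeasurable hf.1]
  exact (integral_prod _ (hF.integrable (by norm_num))).symm

/-- The latitude average is an orthogonal projection `E`, for which `⟨f, E f⟩ = ‖E f‖²`. -/
theorem integral_mul_latitudeAverage {ν : Measure (Set.Icc (-1 : ℝ) 1)} [IsProbabilityMeasure ν]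
    (hν : MeasurePreserving join (ν.prod (uniformMeasure d)) (uniformMeasure (d + 1)))
    {f : (Fin n → RoundSphere (d + 1)) → ℝ}
    (hf : MemLp f 2 (Measure.pi fun _ => uniformMeasure (d + 1))) :
    ∫ x, f x * latitudeAverage f (fun i => coord 0 (x i))
        ∂(Measure.pi fun _ => uniformMeasure (d + 1)) =
      ∫ t, latitudeAverage f t ^ 2 ∂(Measure.pi fun _ => ν) := by
  have hJ := measurePreserving_joins (n := n) hν
  have hC : MeasurePreserving (fun (x : Fin n → RoundSphere (d + 1)) i => coord 0 (x i))
      (Measure.pi fun _ => uniformMeasure (d + 1)) (Measure.pi fun _ => ν) :=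
    measurePreserving_pi _ _ fun _ => measurePreserving_coord_zero hν
  have hm : Integrable (fun x => f x * latitudeAverage f (fun i => coord 0 (x i)))
      (Measure.pi fun _ => uniformMeasure (d + 1)) :=
    hf.integrable_mul ((memLp_latitudeAverage hν hf).comp_measurePreserving hC)
  rw [← hJ.integral_comp_of_aestronglyMeasurable hm.1]
  refine (integral_prod _ (hJ.integrable_comp_of_integrable hm)).trans ?_
  refine integral_congr_ae (.of_forall fun t => ?_)
  have hcoord : ∀ y : Fin n → RoundSphere d, (fun i => coord 0 (joins (t, y) i)) = t :=
    fun y => funext fun i => coord_zero_join _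
  simp only [Function.comp_apply, hcoord]
  rw [integral_mul_const, sq]
  rfl

theorem realAverage_suspension (P : MeasurePreservingBijection (uniformMeasure d) →₀ ℝ)
    (f : (Fin n → RoundSphere (d + 1)) → ℝ)
    (p : (Fin n → Set.Icc (-1 : ℝ) 1) × (Fin n → RoundSphere d)) :
    realAverage (P.mapDomain suspension) f (joins p) =
      realAverage P (fun y => f (joins (p.1, y))) p.2 := by
  rw [realAverage, Finsupp.sum_mapDomain_index (by simp) (by intros; ring)]
  refine Finset.sum_congr rfl fun φ _ => ?_
  have : (fun i => (suspension φ).1 (joins p i)) = joins (p.1, fun i => φ.1 (p.2 i)) :=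
    funext fun i => suspend_join _ _ _
  simp only [this]

theorem realAverage_swapConj (P : MeasurePreservingBijection (uniformMeasure d) →₀ ℝ)
    (f : (Fin n → RoundSphere (d + 1)) → ℝ) (x : Fin n → RoundSphere (d + 1)) :
    realAverage (P.mapDomain (swapConj ∘ suspension)) f x =
      realAverage (P.mapDomain suspension) (fun z => f (fun i => swap (z i)))
        (fun i => swap (x i)) := by
  rw [realAverage, Finsupp.sum_mapDomain_index (by simp) (by intros; ring), realAverage,
    Finsupp.sum_mapDomain_index (by simp) (by intros; ring)]
  rfl

/-- On each fibre of fixed heights the suspended average is the average by `P`; the fibrewise bound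
is integrated over the heights. -/
theorem integral_realAverage_suspension_sq_le {ν : Measure (Set.Icc (-1 : ℝ) 1)}
    [IsProbabilityMeasure ν]
    (hν : MeasurePreserving join (ν.prod (uniformMeasure d)) (uniformMeasure (d + 1)))
    {P : MeasurePreservingBijection (uniformMeasure d) →₀ ℝ} (hP : IsProbabilityWeight P) {c : ℝ}
    (h : ∀ f : (Fin n → RoundSphere d) → ℝ, MemLp f 2 (Measure.pi fun _ => uniformMeasure d) →
      ∫ x, f x ∂(Measure.pi fun _ => uniformMeasure d) = 0 →
      ∫ x, realAverage P f x ^ 2 ∂(Measure.pi fun _ => uniformMeasure d) ≤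
        c ^ 2 * ∫ x, f x ^ 2 ∂(Measure.pi fun _ => uniformMeasure d))
    {f : (Fin n → RoundSphere (d + 1)) → ℝ}
    (hf : MemLp f 2 (Measure.pi fun _ => uniformMeasure (d + 1))) :
    ∫ x, realAverage (P.mapDomain suspension) f x ^ 2
        ∂(Measure.pi fun _ => uniformMeasure (d + 1)) ≤
      c ^ 2 * ∫ x, f x ^ 2 ∂(Measure.pi fun _ => uniformMeasure (d + 1)) +
        (1 - c ^ 2) * ∫ t, latitudeAverage f t ^ 2 ∂(Measure.pi fun _ => ν) := by
  have hJ := measurePreserving_joins (n := n) hν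
  have hF : MemLp (fun p => f (joins p)) 2
      ((Measure.pi fun _ => ν).prod (Measure.pi fun _ => uniformMeasure d)) :=
    hf.comp_measurePreserving hJ
  have hT := hf.realAverage (P.mapDomain suspension)
  have hTF : MemLp (fun p => realAverage (P.mapDomain suspension) f (joins p)) 2
      ((Measure.pi fun _ => ν).prod (Measure.pi fun _ => uniformMeasure d)) :=
    hT.comp_measurePreserving hJ
  have hL := memLp_latitudeAverage hν hf
  rw [← hJ.integral_comp_of_aestronglyMeasurable hT.integrable_sq.1,
    ← hJ.integral_comp_of_aestronglyMeasurable hf.integrable_sq.1]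
  rw [integral_prod _ hTF.integrable_sq, integral_prod _ hF.integrable_sq, ← integral_const_mul, ← integral_const_mul, ← integral_add
    (hF.integrable_sq.integral_prod_left.const_mul _) (hL.integrable_sq.const_mul _)]
  refine integral_mono_ae hTF.integrable_sq.integral_prod_left
    ((hF.integrable_sq.integral_prod_left.const_mul _).add (hL.integrable_sq.const_mul _)) ?_
  filter_upwards [hF.ae_fibre] with t ht
  simp only [realAverage_suspension]
  exact integral_realAverage_sq_le hP h ht

/-- With `a = ‖E₀ f‖²`, `b = ‖E₁ f‖²`, one has `a + b = ⟨f, E₀ f + E₁ f⟩`. The correlation bound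
gives `‖E₀ f + E₁ f‖² ≤ a + b + √a √b ≤ (3/2)(a + b)`, and Cauchy–Schwarz concludes after division
by `a + b`. -/
theorem integral_latitudeAverage_sq_add_le {ν : Measure (Set.Icc (-1 : ℝ) 1)}
    [IsProbabilityMeasure ν]
    (hν : MeasurePreserving join (ν.prod (uniformMeasure (d + 1))) (uniformMeasure (d + 2)))
    {f : (Fin n → RoundSphere (d + 2)) → ℝ}
    (hf : MemLp f 2 (Measure.pi fun _ => uniformMeasure (d + 2)))
    (hf0 : ∫ x, f x ∂(Measure.pi fun _ => uniformMeasure (d + 2)) = 0) :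
    ∫ t, latitudeAverage f t ^ 2 ∂(Measure.pi fun _ => ν) +
        ∫ t, latitudeAverage (fun x => f fun i => swap (x i)) t ^ 2 ∂(Measure.pi fun _ => ν) ≤
      3 / 2 * ∫ x, f x ^ 2 ∂(Measure.pi fun _ => uniformMeasure (d + 2)) := by
  have hR : MeasurePreserving (fun (x : Fin n → RoundSphere (d + 2)) i => swap (x i))
      (Measure.pi fun _ => uniformMeasure (d + 2)) (Measure.pi fun _ => uniformMeasure (d + 2)) :=
    measurePreserving_pi _ _ fun _ => measurePreserving_swap
  have hC : MeasurePreserving (fun (x : Fin n → RoundSphere (d + 2)) i => coord 0 (x i))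
      (Measure.pi fun _ => uniformMeasure (d + 2)) (Measure.pi fun _ => ν) :=
    measurePreserving_pi _ _ fun _ => measurePreserving_coord_zero hν
  have hC' := hC.comp hR
  have hf' : MemLp (fun x => f fun i => swap (x i)) 2
      (Measure.pi fun _ => uniformMeasure (d + 2)) := hf.comp_measurePreserving hR
  have hf0' : ∫ x, f (fun i => swap (x i)) ∂(Measure.pi fun _ => uniformMeasure (d + 2)) = 0 := by
    rw [hR.integral_comp_of_aestronglyMeasurable hf.1, hf0]
  have hcorr := (maxCorrLE_coord hν).pi (by norm_num) (measurePreserving_coord_zero hν)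
    ((measurePreserving_coord_zero hν).comp measurePreserving_swap) n
  set F := latitudeAverage f with hFdef
  set G := latitudeAverage (fun x => f fun i => swap (x i)) with hGdef
  have hF : MemLp F 2 (Measure.pi fun _ => ν) := memLp_latitudeAverage hν hf
  have hG : MemLp G 2 (Measure.pi fun _ => ν) := memLp_latitudeAverage hν hf'
  have hFG := hcorr F G hF hG ((integral_latitudeAverage hν hf).trans hf0)
    ((integral_latitudeAverage hν hf').trans hf0')
  have hFC := hF.comp_measurePreserving hC
  have hGC := hG.comp_measurePreserving hC'
  have ifF : Integrable (fun x => f x * F (fun i => coord 0 (x i)))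
      (Measure.pi fun _ => uniformMeasure (d + 2)) := hf.integrable_mul hFC
  have ifG : Integrable (fun x => f x * G (fun i => coord 0 (swap (x i))))
      (Measure.pi fun _ => uniformMeasure (d + 2)) := hf.integrable_mul hGC
  have iFG : Integrable (fun x : Fin n → RoundSphere (d + 2) =>
      F (fun i => coord 0 (x i)) * G (fun i => coord 0 (swap (x i))))
      (Measure.pi fun _ => uniformMeasure (d + 2)) := hFC.integrable_mul hGC
  have e1 := integral_mul_latitudeAverage hν hf
  have e2 : ∫ x, f x * G (fun i => coord 0 (swap (x i)))
      ∂(Measure.pi fun _ => uniformMeasure (d + 2)) =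
        ∫ t, G t ^ 2 ∂(Measure.pi fun _ => ν) := by
    rw [← integral_mul_latitudeAverage hν hf']
    rw [← hR.integral_comp_of_aestronglyMeasurable ifG.1]
    simp [swap_swap, hGdef]
  set a := ∫ t, F t ^ 2 ∂(Measure.pi fun _ => ν) with ha
  set b := ∫ t, G t ^ 2 ∂(Measure.pi fun _ => ν) with hb
  have ha0 : 0 ≤ a := integral_nonneg fun _ => sq_nonneg _
  have hb0 : 0 ≤ b := integral_nonneg fun _ => sq_nonneg _
  set N := ∫ x, f x ^ 2 ∂(Measure.pi fun _ => uniformMeasure (d + 2)) with hN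
  have hN0 : 0 ≤ N := integral_nonneg fun _ => sq_nonneg _
  have hcs := hf.integral_mul_le (hFC.add hGC)
  have e3 : ∫ x, f x * (F (fun i => coord 0 (x i)) + G (fun i => coord 0 (swap (x i))))
      ∂(Measure.pi fun _ => uniformMeasure (d + 2)) = a + b := by
    rw [← e1, ← e2, ← integral_add ifF ifG]
    simp_rw [mul_add]
  have e4 : ∫ x, (F (fun i => coord 0 (x i)) + G (fun i => coord 0 (swap (x i)))) ^ 2
      ∂(Measure.pi fun _ => uniformMeasure (d + 2)) ≤ 3 / 2 * (a + b) := by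
    have i1 := hC.integral_comp_of_aestronglyMeasurable hF.integrable_sq.1
    have i2 := hC'.integral_comp_of_aestronglyMeasurable hG.integrable_sq.1
    have i3 : ∀ x : Fin n → RoundSphere (d + 2),
        (F (fun i => coord 0 (x i)) + G (fun i => coord 0 (swap (x i)))) ^ 2 =
          (F (fun i => coord 0 (x i)) ^ 2 + G (fun i => coord 0 (swap (x i))) ^ 2) +
          2 * (F (fun i => coord 0 (x i)) * G (fun i => coord 0 (swap (x i)))) := fun x => by ring
    have iF2 : Integrable (fun x : Fin n → RoundSphere (d + 2) =>
        F (fun i => coord 0 (x i)) ^ 2) (Measure.pi fun _ => uniformMeasure (d + 2)) :=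
      hFC.integrable_sq
    have iG2 : Integrable (fun x : Fin n → RoundSphere (d + 2) =>
        G (fun i => coord 0 (swap (x i))) ^ 2) (Measure.pi fun _ => uniformMeasure (d + 2)) :=
      hGC.integrable_sq
    have i4 : Integrable (fun x : Fin n → RoundSphere (d + 2) =>
        F (fun i => coord 0 (x i)) ^ 2 + G (fun i => coord 0 (swap (x i))) ^ 2)
        (Measure.pi fun _ => uniformMeasure (d + 2)) := iF2.add iG2
    simp_rw [i3]
    rw [integral_add i4 (iFG.const_mul 2),
      integral_add iF2 iG2, integral_const_mul]
    simp only [Function.comp_apply] at i2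
    rw [i1, i2, ← ha, ← hb]
    have h1 := (le_abs_self _).trans hFG
    have h2 := two_mul_le_add_sq √a √b
    rw [Real.sq_sqrt ha0, Real.sq_sqrt hb0] at h2
    simp only at h1
    linarith
  have h5 : a + b ≤ √N * √(3 / 2 * (a + b)) := by
    rw [← e3]
    exact hcs.trans (mul_le_mul_of_nonneg_left (Real.sqrt_le_sqrt (by rw [e3]; exact e4))
      (Real.sqrt_nonneg _))
  rcases (add_nonneg ha0 hb0).eq_or_lt with h0 | h0
  · rw [← h0]; positivity
  · have h6 := pow_le_pow_left₀ h0.le h5 2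
    rw [mul_pow, Real.sq_sqrt hN0, Real.sq_sqrt (by positivity)] at h6
    nlinarith

theorem expandsUniformly_succ
    (h : ExpandsUniformly (RoundSphere (d + 1)) (uniformMeasure (d + 1))) :
    ExpandsUniformly (RoundSphere (d + 2)) (uniformMeasure (d + 2)) := by
  obtain ⟨K, ρ, hρ0, hρ1, P, hP, hK, hexp⟩ := h
  obtain ⟨ν, _, hν⟩ := exists_measurePreserving_join (d + 1)
  set δ : ℝ := 1 - (1 - ρ) ^ 2 with hδ
  have hδ0 : 0 < δ := by nlinarith
  have hδ1 : δ ≤ 1 := by nlinarith [sq_nonneg (1 - ρ)]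
  have hsum : ∀ g : MeasurePreservingBijection (uniformMeasure (d + 1)) →
      MeasurePreservingBijection (uniformMeasure (d + 2)),
      IsProbabilityWeight (P.mapDomain g) := by
    refine fun g => ⟨fun φ => ?_, ?_⟩
    · classical
      rw [Finsupp.mapDomain, Finsupp.sum_apply]
      refine Finset.sum_nonneg fun ψ _ => ?_
      simp only [Finsupp.single_apply]
      split_ifs
      exacts [hP.1 ψ, le_rfl]
    · rw [Finsupp.sum_mapDomain_index (by simp) (by simp)]
      exact hP.2
  set P₁ := P.mapDomain suspension with hP₁
  set P₂ := P.mapDomain (swapConj ∘ suspension) with hP₂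
  let Q : MeasurePreservingBijection (uniformMeasure (d + 2)) →₀ ℝ :=
    (1 / 2 : ℝ) • P₁ + (1 / 2 : ℝ) • P₂
  have hQavg : ∀ {n : ℕ} (f : (Fin n → RoundSphere (d + 2)) → ℝ) x,
      realAverage Q f x = 1 / 2 * realAverage P₁ f x + 1 / 2 * realAverage P₂ f x := by
    intro n f x
    rw [realAverage, Finsupp.sum_add_index' (by simp) (by intros; ring),
      Finsupp.sum_smul_index (by simp), Finsupp.sum_smul_index (by simp)]
    simp only [mul_assoc, ← Finsupp.mul_sum]
    rfl
  -- The two contractions average to `1 - δ + (δ / 2) * (3 / 2) = 1 - δ / 4`, which is at most `(1 -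
  -- δ / 8) ^ 2`.
  refine ⟨suspensionConstant K, δ / 8, by positivity, by linarith, Q, ⟨fun φ => ?_, ?_⟩, ?_, ?_⟩
  · have h1 := (hsum suspension).1 φ
    have h2 := (hsum (swapConj ∘ suspension)).1 φ
    simp only [Q, Finsupp.add_apply, Finsupp.smul_apply, smul_eq_mul]
    positivity
  · rw [Finsupp.sum_add_index' (by simp) (by simp), Finsupp.sum_smul_index (by simp),
      Finsupp.sum_smul_index (by simp), ← Finsupp.mul_sum, ← Finsupp.mul_sum,
      (hsum suspension).2, (hsum (swapConj ∘ suspension)).2]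
    norm_num
  · classical
    intro φ hφ
    rcases Finset.mem_union.1 (Finsupp.support_add hφ) with h1 | h1
    · obtain ⟨ψ, hψ, rfl⟩ := Finset.mem_image.1
        (Finsupp.mapDomain_support (Finsupp.support_smul h1))
      exact lipschitzWith_suspension (hK ψ hψ)
    · obtain ⟨ψ, hψ, rfl⟩ := Finset.mem_image.1
        (Finsupp.mapDomain_support (Finsupp.support_smul h1))
      exact lipschitzWith_swapConj (lipschitzWith_suspension (hK ψ hψ))
  · intro n hn f hf hf0
    refine eLpNorm_averagingOperator_le (by linarith) (fun g hg hg0 => ?_) hf hf0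
    have hbase : ∀ f : (Fin n → RoundSphere (d + 1)) → ℝ,
        MemLp f 2 (Measure.pi fun _ => uniformMeasure (d + 1)) →
        ∫ x, f x ∂(Measure.pi fun _ => uniformMeasure (d + 1)) = 0 →
        ∫ x, realAverage P f x ^ 2 ∂(Measure.pi fun _ => uniformMeasure (d + 1)) ≤
          (1 - ρ) ^ 2 * ∫ x, f x ^ 2 ∂(Measure.pi fun _ => uniformMeasure (d + 1)) :=
      fun f hf hf0 => integral_realAverage_sq_le_of_eLpNorm_le (by linarith) (hexp n hn) hf hf0
    have hR : MeasurePreserving (fun (x : Fin n → RoundSphere (d + 2)) i => swap (x i))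
        (Measure.pi fun _ => uniformMeasure (d + 2))
        (Measure.pi fun _ => uniformMeasure (d + 2)) :=
      measurePreserving_pi _ _ fun _ => measurePreserving_swap
    have hg' : MemLp (fun x => g fun i => swap (x i)) 2
        (Measure.pi fun _ => uniformMeasure (d + 2)) := hg.comp_measurePreserving hR
    have h1 := integral_realAverage_suspension_sq_le hν hP hbase hg
    have h2 := integral_realAverage_suspension_sq_le hν hP hbase hg'
    have h3 := integral_latitudeAverage_sq_add_le hν hg hg0
    have e1 : ∫ x, g (fun i => swap (x i)) ^ 2 ∂(Measure.pi fun _ => uniformMeasure (d + 2)) =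
        ∫ x, g x ^ 2 ∂(Measure.pi fun _ => uniformMeasure (d + 2)) :=
      hR.integral_comp_of_aestronglyMeasurable hg.integrable_sq.1
    have e2 : ∫ x, realAverage P₂ g x ^ 2 ∂(Measure.pi fun _ => uniformMeasure (d + 2)) =
        ∫ x, realAverage P₁ (fun x => g fun i => swap (x i)) x ^ 2
          ∂(Measure.pi fun _ => uniformMeasure (d + 2)) := by
      rw [← hR.integral_comp_of_aestronglyMeasurable (hg'.realAverage P₁).integrable_sq.1]
      refine integral_congr_ae (.of_forall fun x => ?_)
      simp only [hP₂, realAverage_swapConj]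
      rfl
    have i1 := (hg.realAverage P₁).integrable_sq
    have i2 := (hg.realAverage P₂).integrable_sq
    -- Convexity of the square.
    have h4 : ∫ x, realAverage Q g x ^ 2 ∂(Measure.pi fun _ => uniformMeasure (d + 2)) ≤
        ∫ x, (1 / 2 * realAverage P₁ g x ^ 2 + 1 / 2 * realAverage P₂ g x ^ 2)
          ∂(Measure.pi fun _ => uniformMeasure (d + 2)) := by
      refine integral_mono (hg.realAverage Q).integrable_sq
        ((i1.const_mul _).add (i2.const_mul _)) fun x => ?_
      simp only [hQavg]
      nlinarith [sq_nonneg (realAverage P₁ g x - realAverage P₂ g x)]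
    rw [integral_add (i1.const_mul _) (i2.const_mul _), integral_const_mul, integral_const_mul,
      e2] at h4
    rw [e1] at h2
    have hN : 0 ≤ ∫ x, g x ^ 2 ∂(Measure.pi fun _ => uniformMeasure (d + 2)) :=
      integral_nonneg fun _ => sq_nonneg _
    rw [← hδ] at h1 h2
    have h5 := mul_le_mul_of_nonneg_left h3 hδ0.le
    have h6 := mul_nonneg (sq_nonneg δ) hN
    have h7 : (1 - ρ) ^ 2 = 1 - δ := by rw [hδ]; ring
    rw [h7] at h1 h2
    linarith

end RoundSphere

theorem mainTheorem7 (m : ℕ) (hm : 3 ≤ m)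
    (h : ExpandsUniformly (RoundSphere (m - 1)) (RoundSphere.uniformMeasure (m - 1))) :
    ExpandsUniformly (RoundSphere m) (RoundSphere.uniformMeasure m) := by
  obtain ⟨d, rfl⟩ : ∃ d, m = d + 2 := ⟨m - 2, by omega⟩
  exact RoundSphere.expandsUniformly_succ h
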